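/- Let $\mathbb D=\{z\in\mathbb C : |z|<1\}$. A holomorphic map $f:\mathbb D\to\mathbb C$ is called typically real if $\operatorname{Im} f(z)\cdot\operatorname{Im} z\ge 0$ for all $z\in\mathbb D$. For $\tau\in(0,1]$ let $\mathcal T(\tau)$ be the set of all typically real $f:\mathbb D\to\mathbb D$ with $f(0)=0$ and $f'(0)=\tau$. Let $z_0\in\mathbb D\setminus\{0\}$ and $\tau\in(0,1]$, let $V_{\mathcal T(\tau)}(z_0)=\{f(z_0) : f\in\mathcal T(\tau)\}$, and put $$C_1=\left\{1+\frac{4\tau z_0}{1-2yz_0+z_0^2} : y\in[2\tau-1,1]\right\},\qquad C_2=\left\{\frac{(z_0+1)^2\,(1+z_0(-4+4\tau-2x+z_0))}{(z_0-1)^2\,(1-2xz_0+z_0^2)} : x\in[-1,2\tau-1]\right\}.$$ If $z_0\notin\mathbb R$, then $C_1$ and $C_2$ are circular arcs: each is contained in a circle (for $\tau=1$ it is a single point, a circle of radius $0$). Let $W(\tau)$ be the closed region bounded by $C_1\cup C_2$, that is, the union of $C_1\cup C_2$ with all bounded connected components of $\mathbb C\setminus(C_1\cup C_2)$. Then $W(\tau)$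 is convex, its boundary is $C_1\cup C_2$, it is contained in $\mathbb C\setminus(-\infty,0]$, and $V_{\mathcal T(\tau)}(z_0)$ is the image of $W(\tau)$ under the map $$w\mapsto\frac{\sqrt w-1}{\sqrt w+1},$$ where $\sqrt{\cdot}$ is the holomorphic branch of the square root on $\mathbb C\setminus(-\infty,0]$ with $\sqrt1=1$. -/

import Mathlib

/-- The set of values at `z₀` of the functions in `A`. -/
def valueRegion (A : Set (ℂ → ℂ)) (z₀ : ℂ) : Set ℂ :=
  {w | ∃ f ∈ A, f z₀ = w}

/-- `f` is holomorphic and typically real in the open unit disc. Functions on the disc are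
represented by functions on `ℂ` of which only the restriction to the disc matters. -/
def TypicallyReal (f : ℂ → ℂ) : Prop :=
  DifferentiableOn ℂ f (Metric.ball 0 1) ∧
    ∀ z ∈ Metric.ball (0 : ℂ) 1, 0 ≤ (f z).im * z.im

/-- The typically real self-maps `f` of the open unit disc with `f 0 = 0` and `f' 0 > 0`. -/
def boundedTypicallyReal : Set (ℂ → ℂ) :=
  {f | TypicallyReal f ∧ Set.MapsTo f (Metric.ball 0 1) (Metric.ball 0 1) ∧ f 0 = 0 ∧
    (deriv f 0).im = 0 ∧ 0 < (deriv f 0).re}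

/-- The functions in `boundedTypicallyReal` with derivative `τ` at the origin. -/
def boundedTypicallyRealWithDeriv (τ : ℝ) : Set (ℂ → ℂ) :=
  {f | f ∈ boundedTypicallyReal ∧ deriv f 0 = (τ : ℂ)}

/-- The first arc, parametrized by `y ∈ [2τ - 1, 1]`. -/
noncomputable def firstArc (z₀ : ℂ) (τ : ℝ) : Set ℂ :=
  (fun y : ℝ => 1 + 4 * (τ : ℂ) * z₀ / (1 - 2 * (y : ℂ) * z₀ + z₀ ^ 2)) '' Set.Icc (2 * τ - 1) 1

/-- The second arc, parametrized by `x ∈ [-1, 2τ - 1]`. -/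
noncomputable def secondArc (z₀ : ℂ) (τ : ℝ) : Set ℂ :=
  (fun x : ℝ =>
    (z₀ + 1) ^ 2 * (1 + z₀ * (-4 + 4 * (τ : ℂ) - 2 * (x : ℂ) + z₀)) /
      ((z₀ - 1) ^ 2 * (1 - 2 * (x : ℂ) * z₀ + z₀ ^ 2))) '' Set.Icc (-1) (2 * τ - 1)

/-- The closed region bounded by a closed plane curve with trace `C`: the points of `C` together
with all points that lie in a bounded connected component of the complement of `C`. -/
def closedRegionBoundedBy (C : Set ℂ) : Set ℂ :=
  C ∪ {w | w ∉ C ∧ Bornology.IsBounded (connectedComponentIn Cᶜ w)}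

/-! The squared Cayley transform `h = ((1 + f) / (1 - f)) ^ 2` turns the functions `f` into the
class `slitTypicallyReal τ`, with inverse `(√h - 1) / (√h + 1)`. This class is convex: at each point
all its members have imaginary parts of the same sign, so a convex combination cannot fall on the
slit. Hence its value region `K` at `z₀` is convex, and it remains to show that `K` is the lens `L`
cut out by two discs whose circles carry the arcs.

`K ⊆ L`: if `g` is typically real with `g 0 = 0` and derivative `σ > 0` at the origin, then `z + 1 /
z - σ / g` is again typically real (minimum principle on half discs). The sign of its imaginary part
confines `g z₀` to a disc whose circle passes through the origin (`TypicallyReal.norm_sq_le`). One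
disc comes from `g = h - 1`, with `σ = 4 τ`. The other comes from `g = 1 - h / M`, with `M = ((1 +
z) / (1 - z)) ^ 2` and `σ = 4 (1 - τ)`; that this `g` is typically real is a form of Schwarz–Pick:
`f` does not increase the hyperbolic distance to the real diameter (`im_mul_one_sub_norm_sq_le`).

`L ⊆ K`: explicit combinations of the functions `z / (1 - 2 y z + z ^ 2)` show that both arcs lie in
`K`. The arcs together are exactly the frontier of `L`, and a convex set containing the frontier of
a compact set contains the set (`Convex.eq_of_frontier_subset`).

Two cases degenerate. For `τ = 1` the second disc is a point. For real `z₀` there is no lens, and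
monotonicity of `z + 1 / z - σ / g` on the real diameter takes its place. -/

/-! ### Compact convex plane sets and their frontiers. -/

theorem IsPreconnected.inter_frontier_of_isClosed {X : Type*} [TopologicalSpace X] {S L : Set X}
    (hS : IsPreconnected S) (hL : IsClosed L) (h1 : (S ∩ L).Nonempty) (h2 : (S ∩ Lᶜ).Nonempty) :
    (S ∩ frontier L).Nonempty := by
  by_contra hne
  have hint : ∀ x ∈ S, x ∈ L → x ∈ interior L := by
    intro x hx hxL
    by_contra hxi
    exact hne ⟨x, hx, by rw [hL.frontier_eq]; exact ⟨hxL, hxi⟩⟩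
  obtain ⟨x, hx, hxL⟩ := h1
  obtain ⟨y, -, hy1, hy2⟩ := hS (interior L) Lᶜ isOpen_interior hL.isOpen_compl
    (fun x hx => (em (x ∈ L)).imp (hint x hx) id) ⟨x, hx, hint x hx hxL⟩ h2
  exact hy2 (interior_subset hy1)

/-- Every ray issuing from a point of a bounded closed set meets its frontier. -/
theorem IsCompact.exists_ray_mem_frontier {L : Set ℂ} (hc : IsCompact L) {p v : ℂ} (hp : p ∈ L)
    (hv : v ≠ 0) : ∃ t : ℝ, 0 ≤ t ∧ p + t * v ∈ frontier L := by
  obtain ⟨R, hR⟩ := hc.isBounded.exists_norm_le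
  have hR0 : 0 ≤ R := (norm_nonneg _).trans (hR p hp)
  have hv0 : 0 < ‖v‖ := norm_pos_iff.2 hv
  have hγ : Continuous fun t : ℝ => p + (t : ℂ) * v := by fun_prop
  have hpre : IsPreconnected ((fun t : ℝ => p + (t : ℂ) * v) '' Set.Ici 0) :=
    isPreconnected_Ici.image _ hγ.continuousOn
  set t : ℝ := (R + ‖p‖ + 1) / ‖v‖ with ht
  have ht0 : 0 ≤ t := by positivity
  obtain ⟨_, ⟨s, hs, rfl⟩, hsf⟩ := hpre.inter_frontier_of_isClosed hc.isClosed
    ⟨p, ⟨0, by simp, by simp⟩, hp⟩ ⟨p + (t : ℂ) * v, ⟨t, ht0, rfl⟩, by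
      intro hL
      have h1 := hR _ hL
      have h2 : ‖(t : ℂ) * v‖ = R + ‖p‖ + 1 := by
        rw [norm_mul, Complex.norm_real, Real.norm_of_nonneg ht0, ht]
        field_simp
      have h3 : ‖(t : ℂ) * v‖ ≤ ‖p + (t : ℂ) * v‖ + ‖p‖ := by
        simpa using norm_sub_le (p + (t : ℂ) * v) p
      linarith⟩
  exact ⟨s, hs, hsf⟩

/-- From a point `w` outside `L`, the ray pointing away from some `p ∈ L` never meets `L`, since
otherwise `w` would lie on a chord; so the component of `w` is unbounded. The component of an
interior point cannot cross the frontier and stays in `L`. -/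
theorem closedRegionBoundedBy_frontier {L : Set ℂ} (hc : IsCompact L) (hconv : Convex ℝ L)
    (hne : L.Nonempty) : closedRegionBoundedBy (frontier L) = L := by
  ext w
  constructor
  · rintro (hw | ⟨hw, hb⟩)
    · exact hc.isClosed.frontier_subset hw
    · by_contra hwL
      obtain ⟨p, hp⟩ := hne
      let γ : ℝ → ℂ := fun t => w + (t : ℂ) * (w - p)
      have hγ : Continuous γ := by fun_prop
      have hsub : γ '' Set.Ici 0 ⊆ (frontier L)ᶜ := by
        rintro _ ⟨t, ht, rfl⟩ hf
        have ht0 : (0 : ℝ) ≤ t := ht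
        have hL : γ t ∈ L := hc.isClosed.frontier_subset hf
        apply hwL
        have ht1 : (0 : ℝ) < 1 + t := by linarith
        have := hconv hL hp (a := 1 / (1 + t)) (b := t / (1 + t)) (by positivity) (by positivity)
          (by field_simp)
        convert this using 1
        have h1 : (1 + t : ℂ) ≠ 0 := by exact_mod_cast ht1.ne'
        simp only [γ, Complex.real_smul]
        push_cast
        field_simp
        ring
      have hpre : IsPreconnected (γ '' Set.Ici 0) :=
        isPreconnected_Ici.image _ hγ.continuousOn
      have hwγ : w ∈ γ '' Set.Ici 0 := ⟨0, by simp, by simp [γ]⟩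
      have hb' := hb.subset (hpre.subset_connectedComponentIn hwγ hsub)
      obtain ⟨R, hR⟩ := hb'.exists_norm_le
      have hwp : 0 < ‖w - p‖ := norm_pos_iff.2 (sub_ne_zero.2 fun h => hwL (h ▸ hp))
      have hR0 : 0 ≤ R := (norm_nonneg _).trans (hR w hwγ)
      set t : ℝ := (R + ‖w‖ + 1) / ‖w - p‖ with ht
      have ht0 : 0 ≤ t := by positivity
      have h1 := hR (γ t) ⟨t, ht0, rfl⟩
      have h2 : ‖(t : ℂ) * (w - p)‖ = R + ‖w‖ + 1 := by
        rw [norm_mul, Complex.norm_real, Real.norm_of_nonneg ht0, ht]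
        field_simp
      have h3 : ‖(t : ℂ) * (w - p)‖ ≤ ‖γ t‖ + ‖w‖ := by
        have : (t : ℂ) * (w - p) = γ t - w := by simp [γ]
        rw [this]
        exact norm_sub_le _ _
      linarith
  · intro hw
    by_cases hf : w ∈ frontier L
    · exact Or.inl hf
    · refine Or.inr ⟨hf, hc.isBounded.subset ?_⟩
      intro v hv
      by_contra hvL
      have hpre : IsPreconnected (connectedComponentIn (frontier L)ᶜ w) :=
        isPreconnected_connectedComponentIn
      have hwm : w ∈ connectedComponentIn (frontier L)ᶜ w := mem_connectedComponentIn hf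
      obtain ⟨x, hx, hx'⟩ := hpre.inter_frontier_of_isClosed hc.isClosed ⟨w, hwm, hw⟩ ⟨v, hv, hvL⟩
      exact connectedComponentIn_subset _ _ hx hx'

/-- Follow the horizontal line through a point in both directions until it meets the frontier; the
point lies between the two hits. -/
theorem subset_convexHull_frontier {L : Set ℂ} (hc : IsCompact L) :
    L ⊆ convexHull ℝ (frontier L) := by
  intro p hp
  obtain ⟨t, ht, h1⟩ := hc.exists_ray_mem_frontier hp one_ne_zero
  obtain ⟨s, hs, h2⟩ := hc.exists_ray_mem_frontier hp (neg_ne_zero.2 one_ne_zero)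
  rcases ht.eq_or_lt with rfl | ht
  · simpa using subset_convexHull ℝ _ h1
  have := (convex_convexHull ℝ (frontier L)) (subset_convexHull ℝ _ h1) (subset_convexHull ℝ _ h2)
    (a := s / (s + t)) (b := t / (s + t)) (by positivity) (by positivity) (by field_simp)
  convert this using 1
  have h3 : (s + t : ℂ) ≠ 0 := by exact_mod_cast (by linarith : 0 < s + t).ne'
  simp only [Complex.real_smul]
  push_cast
  field_simp
  ring

/-- A convex set squeezed between the boundary of a compact convex set and that set is
all of it. -/
theorem Convex.eq_of_frontier_subset {K L : Set ℂ} (hK : Convex ℝ K) (hc : IsCompact L)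
    (hKL : K ⊆ L) (hfr : frontier L ⊆ K) : K = L :=
  hKL.antisymm ((subset_convexHull_frontier hc).trans (convexHull_min hfr hK))

/-! ### Typically real functions: boundary behaviour and Rogosinski's inequality. -/

open Filter Topology in
-- `Im f (z + i t)` has the sign of `t`; let `t → 0` from either side.
theorem TypicallyReal.im_eq_zero {f : ℂ → ℂ} (hf : TypicallyReal f) {z : ℂ}
    (hz : z ∈ Metric.ball (0 : ℂ) 1) (hz' : z.im = 0) : (f z).im = 0 := by
  have hcont : ContinuousAt f z :=
    (hf.1.differentiableAt (Metric.isOpen_ball.mem_nhds hz)).continuousAt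
  have hγ : ContinuousAt (fun t : ℝ => z + t * Complex.I) 0 := by fun_prop
  have hγ0 : z + ((0 : ℝ) : ℂ) * Complex.I = z := by simp
  have hφ : ContinuousAt (fun t : ℝ => (f (z + t * Complex.I)).im) 0 := by
    refine Complex.continuous_im.continuousAt.comp (ContinuousAt.comp ?_ hγ)
    rwa [hγ0]
  have hmem : ∀ᶠ t : ℝ in 𝓝 0, z + t * Complex.I ∈ Metric.ball (0 : ℂ) 1 :=
    hγ.eventually_mem (by simpa only [hγ0] using Metric.isOpen_ball.mem_nhds hz)
  have hsign : ∀ᶠ t : ℝ in 𝓝 0, 0 ≤ (f (z + t * Complex.I)).im * t := by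
    filter_upwards [hmem] with t ht
    simpa [hz'] using hf.2 _ ht
  have h0 : (f (z + ((0 : ℝ) : ℂ) * Complex.I)).im = (f z).im := by rw [hγ0]
  rw [← h0]
  apply le_antisymm
  · refine le_of_tendsto (hφ.tendsto.mono_left nhdsWithin_le_nhds : Tendsto _ (𝓝[<] (0 : ℝ)) _) ?_
    filter_upwards [nhdsWithin_le_nhds hsign, self_mem_nhdsWithin] with t ht ht0
    exact nonpos_of_mul_nonneg_left ht ht0
  · refine ge_of_tendsto (hφ.tendsto.mono_left nhdsWithin_le_nhds : Tendsto _ (𝓝[>] (0 : ℝ)) _) ?_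
    filter_upwards [nhdsWithin_le_nhds hsign, self_mem_nhdsWithin] with t ht ht0
    exact nonneg_of_mul_nonneg_left ht ht0

/-- Maximum modulus for `exp (-P)`, whose norm is `exp (-Re P)`. -/
theorem DiffContOnCl.le_re_of_forall_mem_frontier {P : ℂ → ℂ} {U : Set ℂ} {c : ℝ}
    (hU : Bornology.IsBounded U) (hP : DiffContOnCl ℂ P U) (h : ∀ z ∈ frontier U, c ≤ (P z).re)
    {z : ℂ} (hz : z ∈ closure U) : c ≤ (P z).re := by
  have h1 : DiffContOnCl ℂ (fun z => Complex.exp (-P z)) U :=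
    ⟨hP.1.neg.cexp, hP.2.neg.cexp⟩
  have h2 := Complex.norm_le_of_forall_mem_frontier_norm_le hU h1 (C := Real.exp (-c))
    (fun w hw => by
      rw [Complex.norm_exp, Real.exp_le_exp, Complex.neg_re]
      exact neg_le_neg (h w hw)) hz
  rw [Complex.norm_exp, Real.exp_le_exp, Complex.neg_re] at h2
  linarith

theorem TypicallyReal.neg_comp_neg {f : ℂ → ℂ} (hf : TypicallyReal f) :
    TypicallyReal fun z => -f (-z) := by
  have hmaps : Set.MapsTo (fun z : ℂ => -z) (Metric.ball 0 1) (Metric.ball 0 1) := by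
    intro z hz
    simpa using hz
  refine ⟨(hf.1.comp differentiable_neg.differentiableOn hmaps).neg, fun z hz => ?_⟩
  simpa using hf.2 (-z) (hmaps hz)

theorem DifferentiableOn.dslope_zero {f : ℂ → ℂ} (hf : DifferentiableOn ℂ f (Metric.ball 0 1)) :
    DifferentiableOn ℂ (dslope f 0) (Metric.ball 0 1) :=
  (Complex.differentiableOn_dslope (Metric.isOpen_ball.mem_nhds (by simp))).2 hf

theorem mul_dslope_zero {f : ℂ → ℂ} (h0 : f 0 = 0) (z : ℂ) : z * dslope f 0 z = f z := by
  have := sub_smul_dslope f 0 z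
  simpa [h0] using this

open Filter Topology in
/-- Rogosinski: `(1 - z²) f(z) / z` has nonnegative real part for typically real `f`. -/
theorem TypicallyReal.re_mul_dslope_nonneg {f : ℂ → ℂ} (hf : TypicallyReal f) (h0 : f 0 = 0)
    {z : ℂ} (hz : z ∈ Metric.ball (0 : ℂ) 1) : 0 ≤ ((1 - z ^ 2) * dslope f 0 z).re := by
  have hd := hf.1.dslope_zero
  -- Dilating by `r < 1` makes the function holomorphic up to the unit circle, where the minimum
  -- principle applies; `r → 1` at the end.
  have key : ∀ r : ℝ, 0 < r → r < 1 → 0 ≤ ((1 - z ^ 2) * dslope f 0 (r * z)).re := by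
    intro r hr0 hr1
    have hmaps : ∀ w ∈ Metric.closedBall (0 : ℂ) 1, (r : ℂ) * w ∈ Metric.ball (0 : ℂ) 1 := by
      intro w hw
      have hw' : ‖w‖ ≤ 1 := by simpa using hw
      have : ‖(r : ℂ) * w‖ = r * ‖w‖ := by
        rw [norm_mul, Complex.norm_real, Real.norm_of_nonneg hr0.le]
      rw [mem_ball_zero_iff, this]
      nlinarith [norm_nonneg w]
    have hD : DifferentiableOn ℂ (fun w => (1 - w ^ 2) * dslope f 0 (r * w))
        (Metric.closedBall 0 1) := by
      refine DifferentiableOn.mul (by fun_prop) (hd.comp (by fun_prop) hmaps)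
    have hP : DiffContOnCl ℂ (fun w => (1 - w ^ 2) * dslope f 0 (r * w)) (Metric.ball 0 1) := by
      apply DifferentiableOn.diffContOnCl
      rwa [closure_ball _ one_ne_zero]
    refine hP.le_re_of_forall_mem_frontier Metric.isBounded_ball (fun w hw => ?_)
      (subset_closure hz)
    rw [frontier_ball _ one_ne_zero, mem_sphere_zero_iff_norm] at hw
    have hwn : w.re ^ 2 + w.im ^ 2 = 1 := by
      have := Complex.sq_norm w
      rw [hw, Complex.normSq_apply] at this
      nlinarith
    have hw0 : w ≠ 0 := by
      rintro rfl
      simp at hw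
    -- On the unit circle `1 - w²` is `w` times the purely imaginary number `-2 i Im w`, so the real
    -- part in question becomes `2 Im w · Im f (r w) / r`.
    have hconj : (1 - w ^ 2) = w * (starRingEnd ℂ w - w) := by
      have : w * starRingEnd ℂ w = 1 := by
        rw [Complex.mul_conj, Complex.normSq_eq_norm_sq, hw]
        simp
      linear_combination -this
    have hrc : (r : ℂ) ≠ 0 := by exact_mod_cast hr0.ne'
    have h1 : (1 - w ^ 2) * dslope f 0 (r * w)
        = ((1 / r : ℝ) : ℂ) * ((starRingEnd ℂ w - w) * f (r * w)) := by
      rw [hconj, ← mul_dslope_zero h0 (r * w)]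
      push_cast
      field_simp
    have h2 := hf.2 _ (hmaps w (by simp [hw]))
    rw [h1, Complex.re_ofReal_mul]
    refine mul_nonneg (by positivity) ?_
    have h3 : ((r : ℂ) * w).im = r * w.im := by simp
    rw [h3] at h2
    have h4 : 0 ≤ (f (r * w)).im * w.im := by
      by_contra hneg
      push Not at hneg
      nlinarith
    simp
    nlinarith
  have hc : ContinuousAt (fun r : ℝ => ((1 - z ^ 2) * dslope f 0 (r * z)).re) 1 := by
    have h1 : ContinuousAt (dslope f 0) (((1 : ℝ) : ℂ) * z) := by
      have : ((1 : ℝ) : ℂ) * z = z := by simp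
      rw [this]
      exact (hd.differentiableAt (Metric.isOpen_ball.mem_nhds hz)).continuousAt
    have h2 : ContinuousAt (fun r : ℝ => (r : ℂ) * z) 1 := by fun_prop
    have h3 := ContinuousAt.comp (f := fun r : ℝ => (r : ℂ) * z) h1 h2
    exact Complex.continuous_re.continuousAt.comp (continuousAt_const.mul h3)
  have := ge_of_tendsto (hc.tendsto.mono_left nhdsWithin_le_nhds : Tendsto _ (𝓝[<] (1 : ℝ)) _) (b := 0)
    (by
      filter_upwards [Ioo_mem_nhdsLT (zero_lt_one' ℝ)] with r hr
      exact key r hr.1 hr.2)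
  simpa using this

/-- A zero of the real part would be an interior maximum of the norm of `exp (-(1 - w²) f w / w)`,
making that function constant, against its value at the origin. -/
theorem TypicallyReal.re_mul_dslope_pos {f : ℂ → ℂ} (hf : TypicallyReal f) (h0 : f 0 = 0)
    (hσ : 0 < (deriv f 0).re) {z : ℂ} (hz : z ∈ Metric.ball (0 : ℂ) 1) :
    0 < ((1 - z ^ 2) * dslope f 0 z).re := by
  by_contra hneg
  have hle : ((1 - z ^ 2) * dslope f 0 z).re = 0 :=
    le_antisymm (not_lt.1 hneg) (hf.re_mul_dslope_nonneg h0 hz)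
  have hd : DifferentiableOn ℂ (fun w => Complex.exp (-((1 - w ^ 2) * dslope f 0 w)))
      (Metric.ball 0 1) :=
    (DifferentiableOn.mul (by fun_prop) hf.1.dslope_zero).neg.cexp
  have hmax : IsMaxOn (norm ∘ fun w => Complex.exp (-((1 - w ^ 2) * dslope f 0 w)))
      (Metric.ball 0 1) z := by
    intro w hw
    simp only [Set.mem_ofPred_eq, Function.comp, Complex.norm_exp, Complex.neg_re, hle]
    exact Real.exp_le_exp.2 (neg_le_neg (hf.re_mul_dslope_nonneg h0 hw))
  have h1 := Complex.eqOn_of_isPreconnected_of_isMaxOn_norm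
    (convex_ball (0 : ℂ) 1).isPreconnected Metric.isOpen_ball hd hz hmax
    (show (0 : ℂ) ∈ Metric.ball (0 : ℂ) 1 by simp)
  have h2 := congrArg norm h1
  simp only [Function.const_apply, Complex.norm_exp, Complex.neg_re, hle] at h2
  simp at h2
  linarith

theorem TypicallyReal.dslope_ne_zero {f : ℂ → ℂ} (hf : TypicallyReal f) (h0 : f 0 = 0)
    (hσ : 0 < (deriv f 0).re) {z : ℂ} (hz : z ∈ Metric.ball (0 : ℂ) 1) : dslope f 0 z ≠ 0 := by
  intro h
  simpa [h] using hf.re_mul_dslope_pos h0 hσ hz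

/-! ### The function `z + 1 / z - f'(0) / f(z)` is again typically real. -/

/-- The holomorphic extension to the origin of `z + 1 / z - f'(0) / f(z)`. -/
noncomputable def reciprocalDefect (f : ℂ → ℂ) (z : ℂ) : ℂ :=
  z + dslope (dslope f 0) 0 z / dslope f 0 z

theorem reciprocalDefect_eq {f : ℂ → ℂ} (hf : TypicallyReal f) (h0 : f 0 = 0)
    (hσ : 0 < (deriv f 0).re) {z : ℂ} (hz : z ∈ Metric.ball (0 : ℂ) 1) (hz0 : z ≠ 0) :
    reciprocalDefect f z = z + 1 / z - deriv f 0 / f z := by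
  have h1 := hf.dslope_ne_zero h0 hσ hz
  have h2 := mul_dslope_zero h0 z
  have h3 := sub_smul_dslope (dslope f 0) 0 z
  simp only [sub_zero, dslope_same, smul_eq_mul] at h3
  have h4 : f z ≠ 0 := by
    rw [← h2]
    exact mul_ne_zero hz0 h1
  rw [reciprocalDefect, ← h2]
  field_simp
  linear_combination h3

theorem TypicallyReal.differentiableOn_reciprocalDefect {f : ℂ → ℂ} (hf : TypicallyReal f)
    (h0 : f 0 = 0) (hσ : 0 < (deriv f 0).re) :
    DifferentiableOn ℂ (reciprocalDefect f) (Metric.ball 0 1) :=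
  differentiableOn_id.add
    (hf.1.dslope_zero.dslope_zero.div hf.1.dslope_zero fun _ hz => hf.dslope_ne_zero h0 hσ hz)

open Filter Topology in
theorem reciprocalDefect_im_eq_zero {f : ℂ → ℂ} (hf : TypicallyReal f) (h0 : f 0 = 0)
    {σ : ℝ} (hd : deriv f 0 = σ) (hσ : 0 < σ) {z : ℂ}
    (hz : z ∈ Metric.ball (0 : ℂ) 1) (hz' : z.im = 0) : (reciprocalDefect f z).im = 0 := by
  have hσ' : 0 < (deriv f 0).re := by simpa [hd]
  have key : ∀ w ∈ Metric.ball (0 : ℂ) 1, w.im = 0 → w ≠ 0 → (reciprocalDefect f w).im = 0 := by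
    intro w hw hw' hw0
    rw [reciprocalDefect_eq hf h0 hσ' hw hw0, hd]
    have h1 : f w = ((f w).re : ℂ) := Complex.ext rfl (by simp [hf.im_eq_zero hw hw'])
    have h2 : w = (w.re : ℂ) := Complex.ext rfl (by simp [hw'])
    rw [h1, h2]
    norm_cast
  rcases eq_or_ne z 0 with rfl | hz0
  · have hc : ContinuousAt (reciprocalDefect f) (((0 : ℝ) : ℂ)) := by
      simpa using ((hf.differentiableOn_reciprocalDefect h0 hσ').differentiableAt
        (Metric.isOpen_ball.mem_nhds hz)).continuousAt
    have hc' : ContinuousAt (fun t : ℝ => (reciprocalDefect f t).im) 0 :=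
      Complex.continuous_im.continuousAt.comp
        (ContinuousAt.comp (f := fun t : ℝ => (t : ℂ)) hc Complex.continuous_ofReal.continuousAt)
    have h1 : Tendsto (fun t : ℝ => (reciprocalDefect f t).im) (𝓝[>] (0 : ℝ)) (𝓝 0) := by
      refine tendsto_const_nhds.congr' ?_
      filter_upwards [Ioo_mem_nhdsGT (zero_lt_one' ℝ)] with t ht
      refine (key t ?_ (by simp) (by exact_mod_cast ht.1.ne')).symm
      rw [mem_ball_zero_iff, Complex.norm_real, Real.norm_of_nonneg ht.1.le]
      exact ht.2
    simpa using tendsto_nhds_unique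
      (hc'.tendsto.mono_left nhdsWithin_le_nhds : Tendsto _ (𝓝[>] (0 : ℝ)) _) h1
  · exact key z hz hz' hz0

theorem im_add_one_div (z : ℂ) : (z + 1 / z).im = z.im * (1 - 1 / ‖z‖ ^ 2) := by
  rw [Complex.add_im, one_div, Complex.inv_im, Complex.normSq_eq_norm_sq]
  ring

open Filter Topology in
-- Minimum principle on the half disc of radius `r`: the imaginary part is `0` on the diameter, and
-- on the arc the term `-σ / f` contributes a nonnegative amount while `Im (w + 1 / w) ≥ 1 - 1 /
-- r²`. The bound tends to `0` as `r → 1`.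
theorem reciprocalDefect_im_nonneg {f : ℂ → ℂ} (hf : TypicallyReal f) (h0 : f 0 = 0)
    {σ : ℝ} (hd : deriv f 0 = σ) (hσ : 0 < σ) {z : ℂ}
    (hz : z ∈ Metric.ball (0 : ℂ) 1) (hz' : 0 < z.im) : 0 ≤ (reciprocalDefect f z).im := by
  have hσ' : 0 < (deriv f 0).re := by simpa [hd]
  have hzn : ‖z‖ < 1 := by simpa using hz
  have hD := hf.differentiableOn_reciprocalDefect h0 hσ'
  have key : ∀ r : ℝ, ‖z‖ < r → r < 1 → 1 - 1 / r ^ 2 ≤ (reciprocalDefect f z).im := by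
    intro r hzr hr1
    have hr0 : 0 < r := (norm_nonneg z).trans_lt hzr
    set U : Set ℂ := Metric.ball 0 r ∩ {w | 0 < w.im} with hU
    have hUo : IsOpen U :=
      Metric.isOpen_ball.inter (isOpen_lt continuous_const Complex.continuous_im)
    have hcl : closure U ⊆ Metric.closedBall 0 r ∩ {w | 0 ≤ w.im} :=
      closure_minimal
        (Set.inter_subset_inter Metric.ball_subset_closedBall fun w (hw : 0 < w.im) => hw.le)
        (Metric.isClosed_closedBall.inter (isClosed_le continuous_const Complex.continuous_im))
    have hcb : closure U ⊆ Metric.ball 0 1 := fun w hw =>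
      Metric.closedBall_subset_ball hr1 (hcl hw).1
    have hP : DiffContOnCl ℂ (fun w => -Complex.I * reciprocalDefect f w) U :=
      ((hD.mono hcb).const_mul _).diffContOnCl
    have h1 := hP.le_re_of_forall_mem_frontier (c := 1 - 1 / r ^ 2)
      (Metric.isBounded_ball.subset Set.inter_subset_left) (fun w hw => ?_)
      (subset_closure (show z ∈ U from ⟨by simpa using hzr, hz'⟩))
    · simpa using h1
    · have hw1 := hw.1
      have hwb := hcb hw1
      obtain ⟨hwr, hwi⟩ := hcl hw1
      have hwr' : ‖w‖ ≤ r := by simpa using hwr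
      have hwi' : 0 ≤ w.im := hwi
      have hneg : 1 - 1 / r ^ 2 ≤ 0 := by
        rw [sub_nonpos, le_div_iff₀ (by positivity)]
        nlinarith
      have hre : (-Complex.I * reciprocalDefect f w).re = (reciprocalDefect f w).im := by simp
      rw [hre]
      rcases hwi'.eq_or_lt with hwi0 | hwi0
      · rw [reciprocalDefect_im_eq_zero hf h0 hd hσ hwb hwi0.symm]
        exact hneg
      · have hwn : ‖w‖ = r := by
          by_contra hne
          exact hw.2 (by
            rw [hUo.interior_eq]
            exact ⟨by simpa using lt_of_le_of_ne hwr' hne, hwi0⟩)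
        have hw0 : w ≠ 0 := by
          rintro rfl
          simp at hwi0
        have h2 : 0 ≤ (f w).im := by
          have := hf.2 w hwb
          exact nonneg_of_mul_nonneg_left this hwi0
        have h3 : (deriv f 0 / f w).im ≤ 0 := by
          rw [hd, div_eq_mul_inv, Complex.im_ofReal_mul, Complex.inv_im]
          have : 0 ≤ (f w).im / Complex.normSq (f w) := div_nonneg h2 (Complex.normSq_nonneg _)
          rw [neg_div]
          nlinarith
        rw [reciprocalDefect_eq hf h0 hσ' hwb hw0, Complex.sub_im, im_add_one_div, hwn]
        have h4 : w.im ≤ 1 := (Complex.im_le_norm w).trans (by linarith)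
        nlinarith
  have hlim : Tendsto (fun r : ℝ => 1 - 1 / r ^ 2) (𝓝[<] (1 : ℝ)) (𝓝 0) := by
    have : ContinuousAt (fun r : ℝ => 1 - 1 / r ^ 2) 1 := by
      refine continuousAt_const.sub (ContinuousAt.div continuousAt_const (by fun_prop) (by simp))
    simpa using (this.tendsto.mono_left nhdsWithin_le_nhds : Tendsto _ (𝓝[<] (1 : ℝ)) _)
  refine le_of_tendsto hlim ?_
  filter_upwards [Ioo_mem_nhdsLT hzn] with r hr
  exact key r hr.1 hr.2

/-- The symmetry `f ↦ -f (-z)` carries the estimate from the upper to the lower half disc. -/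
theorem reciprocalDefect_neg_comp_neg {f : ℂ → ℂ} (hf : TypicallyReal f) (h0 : f 0 = 0)
    {σ : ℝ} (hd : deriv f 0 = σ) (hσ : 0 < σ) {z : ℂ} (hz : z ∈ Metric.ball (0 : ℂ) 1)
    (hz0 : z ≠ 0) :
    reciprocalDefect (fun z => -f (-z)) (-z) = -reciprocalDefect f z := by
  have hd' : deriv (fun z => -f (-z)) 0 = σ := by
    rw [deriv.fun_neg, deriv_comp_neg]
    simp [hd]
  rw [reciprocalDefect_eq hf.neg_comp_neg (by simp [h0]) (by simpa [hd']) (by simpa using hz)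
    (neg_ne_zero.2 hz0), reciprocalDefect_eq hf h0 (by simpa [hd]) hz hz0, hd, hd', neg_neg,
    div_neg, div_neg]
  ring

theorem TypicallyReal.reciprocalDefect {f : ℂ → ℂ} (hf : TypicallyReal f) (h0 : f 0 = 0)
    {σ : ℝ} (hd : deriv f 0 = σ) (hσ : 0 < σ) : TypicallyReal (reciprocalDefect f) := by
  refine ⟨hf.differentiableOn_reciprocalDefect h0 (by simpa [hd]), fun z hz => ?_⟩
  rcases lt_trichotomy z.im 0 with h | h | h
  · have hz0 : z ≠ 0 := by
      rintro rfl
      simp at h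
    have hd' : deriv (fun z => -f (-z)) 0 = σ := by
      rw [deriv.fun_neg, deriv_comp_neg]
      simp [hd]
    have h1 := reciprocalDefect_im_nonneg hf.neg_comp_neg (by simp [h0]) hd' hσ
      (z := -z) (by simpa using hz) (by simpa using h)
    rw [reciprocalDefect_neg_comp_neg hf h0 hd hσ hz hz0, Complex.neg_im] at h1
    nlinarith
  · simp [h]
  · exact mul_nonneg (reciprocalDefect_im_nonneg hf h0 hd hσ hz h) h.le

/-! ### The extremal typically real functions `z / (1 - 2 y z + z ^ 2)`. -/

theorem robertson_denom_ne_zero {z : ℂ} (hz : z ∈ Metric.ball (0 : ℂ) 1) {y : ℝ}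
    (hy : y ∈ Set.Icc (-1 : ℝ) 1) : 1 - 2 * (y : ℂ) * z + z ^ 2 ≠ 0 := by
  intro h
  have hz1 : z.re ^ 2 + z.im ^ 2 < 1 := by
    have h1 : ‖z‖ < 1 := by simpa using hz
    have h2 := Complex.sq_norm z
    rw [Complex.normSq_apply] at h2
    nlinarith [norm_nonneg z]
  have hre := congrArg Complex.re h
  have him := congrArg Complex.im h
  simp [pow_two] at hre him
  have him' : z.im * (z.re - y) = 0 := by linarith
  obtain ⟨hy1, hy2⟩ := hy
  rcases mul_eq_zero.1 him' with h1 | h1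
  · rw [h1] at hre hz1
    -- This expression is twice the denominator at a real point.
    have h3 : 0 < (1 + z.re) ^ 2 * (1 - y) + (1 - z.re) ^ 2 * (1 + y) := by
      have : z.re < 1 := by nlinarith
      have : -1 < z.re := by nlinarith
      rcases le_or_gt y 0 with h0 | h0
      · have : 0 < (1 + z.re) ^ 2 * (1 - y) := by
          apply mul_pos (pow_pos (by linarith) _) (by linarith)
        have : 0 ≤ (1 - z.re) ^ 2 * (1 + y) := mul_nonneg (sq_nonneg _) (by linarith)
        linarith
      · have : 0 < (1 - z.re) ^ 2 * (1 + y) := by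
          apply mul_pos (pow_pos (by linarith) _) (by linarith)
        have : 0 ≤ (1 + z.re) ^ 2 * (1 - y) := mul_nonneg (sq_nonneg _) (by linarith)
        linarith
    nlinarith
  · have : y = z.re := by linarith
    subst this
    nlinarith

theorem im_robertson_mul_im_pos {z : ℂ} (hz : z ∈ Metric.ball (0 : ℂ) 1) {y : ℝ}
    (hy : y ∈ Set.Icc (-1 : ℝ) 1) (hz' : z.im ≠ 0) :
    0 < (z / (1 - 2 * (y : ℂ) * z + z ^ 2)).im * z.im := by
  have hd := robertson_denom_ne_zero hz hy
  have hz1 : z.re ^ 2 + z.im ^ 2 < 1 := by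
    have h1 : ‖z‖ < 1 := by simpa using hz
    have h2 := Complex.sq_norm z
    rw [Complex.normSq_apply] at h2
    nlinarith [norm_nonneg z]
  have h1 : (z / (1 - 2 * (y : ℂ) * z + z ^ 2)).im * z.im
      = z.im ^ 2 * (1 - (z.re ^ 2 + z.im ^ 2)) / Complex.normSq (1 - 2 * (y : ℂ) * z + z ^ 2) := by
    rw [Complex.div_im]
    simp [pow_two]
    ring
  rw [h1]
  have := Complex.normSq_pos.2 hd
  have h2 : 0 < z.im ^ 2 := by positivity
  exact div_pos (mul_pos h2 (by linarith)) this

theorem typicallyReal_robertson {y : ℝ} (hy : y ∈ Set.Icc (-1 : ℝ) 1) :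
    TypicallyReal fun z => z / (1 - 2 * (y : ℂ) * z + z ^ 2) := by
  refine ⟨DifferentiableOn.div (by fun_prop) (by fun_prop) fun z hz =>
    robertson_denom_ne_zero hz hy, fun z hz => ?_⟩
  rcases eq_or_ne z.im 0 with h | h
  · simp [h]
  · exact (im_robertson_mul_im_pos hz hy h).le

theorem hasDerivAt_robertson (y : ℝ) :
    HasDerivAt (fun z : ℂ => z / (1 - 2 * (y : ℂ) * z + z ^ 2)) 1 0 := by
  have h1 : HasDerivAt (fun z : ℂ => 1 - 2 * (y : ℂ) * z + z ^ 2) (-(2 * (y : ℂ))) 0 := by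
    have := (((hasDerivAt_id' (0 : ℂ)).const_mul (2 * (y : ℂ))).const_sub 1).fun_add
      ((hasDerivAt_id' (0 : ℂ)).fun_pow 2)
    simpa using this
  have := (hasDerivAt_id' (0 : ℂ)).fun_div h1 (by simp)
  simpa using this

theorem TypicallyReal.add {f g : ℂ → ℂ} (hf : TypicallyReal f) (hg : TypicallyReal g) :
    TypicallyReal fun z => f z + g z := by
  refine ⟨hf.1.add hg.1, fun z hz => ?_⟩
  have := hf.2 z hz
  have := hg.2 z hz
  rw [Complex.add_im]
  linarith

theorem TypicallyReal.const_mul {f : ℂ → ℂ} (hf : TypicallyReal f) {c : ℝ} (hc : 0 ≤ c) :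
    TypicallyReal fun z => (c : ℂ) * f z := by
  refine ⟨hf.1.const_mul _, fun z hz => ?_⟩
  have := hf.2 z hz
  rw [Complex.im_ofReal_mul, mul_assoc]
  positivity

theorem TypicallyReal.differentiableAt_zero {f : ℂ → ℂ} (hf : TypicallyReal f) :
    DifferentiableAt ℂ f 0 :=
  hf.1.differentiableAt (Metric.isOpen_ball.mem_nhds (by simp))

/-! ### The disc estimate, and monotonicity on the real diameter. -/

open Filter Topology in
/-- The values at `z` of typically real functions lie in a disc through the origin. -/
theorem TypicallyReal.norm_sq_le {f : ℂ → ℂ} (hf : TypicallyReal f) (h0 : f 0 = 0)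
    {σ : ℝ} (hd : deriv f 0 = σ) (hσ : 0 ≤ σ) {z : ℂ}
    (hz : z ∈ Metric.ball (0 : ℂ) 1) (hz0 : z ≠ 0) :
    z.im ^ 2 * (1 / ‖z‖ ^ 2 - 1) * ‖f z‖ ^ 2 ≤ σ * ((f z).im * z.im) := by
  have key : ∀ {f : ℂ → ℂ} (_ : TypicallyReal f) (_ : f 0 = 0)
      {σ : ℝ} (_ : deriv f 0 = σ) (_ : 0 < σ),
      z.im ^ 2 * (1 / ‖z‖ ^ 2 - 1) * ‖f z‖ ^ 2 ≤ σ * ((f z).im * z.im) := by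
    intro f hf h0 σ hd hσ
    have hσ' : 0 < (deriv f 0).re := by simpa [hd]
    have h1 := (hf.reciprocalDefect h0 hd hσ).2 z hz
    have hfz : f z ≠ 0 := by
      rw [← mul_dslope_zero h0]
      exact mul_ne_zero hz0 (hf.dslope_ne_zero h0 hσ' hz)
    have hfn : 0 < ‖f z‖ := norm_pos_iff.2 hfz
    rw [reciprocalDefect_eq hf h0 hσ' hz hz0, Complex.sub_im, im_add_one_div, hd,
      div_eq_mul_inv (σ : ℂ),
      Complex.im_ofReal_mul, Complex.inv_im, Complex.normSq_eq_norm_sq] at h1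
    have h2 := mul_nonneg h1 (sq_nonneg ‖f z‖)
    have h3 : ((z.im * (1 - 1 / ‖z‖ ^ 2) - σ * (-(f z).im / ‖f z‖ ^ 2)) * z.im) * ‖f z‖ ^ 2
        = σ * ((f z).im * z.im) - z.im ^ 2 * (1 / ‖z‖ ^ 2 - 1) * ‖f z‖ ^ 2 := by
      field_simp
      ring
    linarith
  -- For `σ = 0` the reciprocal defect is not available, so `f` is perturbed by `ε k` with `k = z /
  -- (1 - z)²`, which makes the derivative `σ + ε > 0`; then `ε → 0`.
  have hy : (1 : ℝ) ∈ Set.Icc (-1 : ℝ) 1 := by simp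
  set k : ℂ → ℂ := fun z => z / (1 - 2 * ((1 : ℝ) : ℂ) * z + z ^ 2) with hk
  have hkt : TypicallyReal k := typicallyReal_robertson hy
  have hε : ∀ ε : ℝ, 0 < ε → z.im ^ 2 * (1 / ‖z‖ ^ 2 - 1) * ‖f z + ε * k z‖ ^ 2 ≤
      (σ + ε) * ((f z + ε * k z).im * z.im) := by
    intro ε hε
    refine key (f := fun z => f z + ε * k z) (hf.add (hkt.const_mul hε.le)) (by simp [h0, hk]) ?_
      (by positivity)
    have := hf.differentiableAt_zero.hasDerivAt.fun_add ((hasDerivAt_robertson 1).const_mul (ε : ℂ))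
    rw [hd] at this
    simpa [hk] using this.deriv
  have h1 : Tendsto (fun ε : ℝ => z.im ^ 2 * (1 / ‖z‖ ^ 2 - 1) * ‖f z + ε * k z‖ ^ 2) (𝓝[>] (0 : ℝ))
      (𝓝 (z.im ^ 2 * (1 / ‖z‖ ^ 2 - 1) * ‖f z + (0 : ℝ) * k z‖ ^ 2)) :=
    (Continuous.tendsto (by fun_prop) 0).mono_left nhdsWithin_le_nhds
  have h2 : Tendsto (fun ε : ℝ => (σ + ε) * ((f z + ε * k z).im * z.im)) (𝓝[>] (0 : ℝ))
      (𝓝 ((σ + (0 : ℝ)) * ((f z + (0 : ℝ) * k z).im * z.im))) :=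
    (Continuous.tendsto (by fun_prop) 0).mono_left nhdsWithin_le_nhds
  have h3 := le_of_tendsto_of_tendsto h1 h2
    (by filter_upwards [self_mem_nhdsWithin] with ε h using hε ε h)
  simpa using h3

open Filter Topology in
-- `Re f' z` is the derivative at `t = 0` of `Im f (z + i t)`, which vanishes at `0` and has the
-- sign of `t`.
theorem TypicallyReal.deriv_re_nonneg {f : ℂ → ℂ} (hf : TypicallyReal f) {z : ℂ}
    (hz : z ∈ Metric.ball (0 : ℂ) 1) (hz' : z.im = 0) : 0 ≤ (deriv f z).re := by
  have hfd : HasDerivAt f (deriv f z) z :=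
    (hf.1.differentiableAt (Metric.isOpen_ball.mem_nhds hz)).hasDerivAt
  have hγ : HasDerivAt (fun t : ℝ => z + t * Complex.I) Complex.I 0 := by
    simpa using ((Complex.ofRealCLM.hasDerivAt (x := (0 : ℝ))).mul_const Complex.I).const_add z
  have hγ0 : z + ((0 : ℝ) : ℂ) * Complex.I = z := by simp
  have h1 : HasDerivAt (fun t : ℝ => f (z + t * Complex.I)) (deriv f z * Complex.I) 0 :=
    HasDerivAt.comp (𝕜' := ℂ) (h₂ := f) (0 : ℝ) (by rwa [hγ0]) hγ
  have h2 : HasDerivAt (fun t : ℝ => (f (z + t * Complex.I)).im) (deriv f z).re 0 := by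
    have := Complex.imCLM.hasFDerivAt.comp_hasDerivAt (0 : ℝ) h1
    rw [show Complex.imCLM (deriv f z * Complex.I) = (deriv f z).re by simp] at this
    exact this
  have h3 := (hasDerivAt_iff_tendsto_slope.1 h2).mono_left
    (nhdsWithin_mono 0 (show Set.Ioi (0 : ℝ) ⊆ {0}ᶜ from fun t ht => ne_of_gt ht))
  have hmem : ∀ᶠ t : ℝ in 𝓝 0, z + t * Complex.I ∈ Metric.ball (0 : ℂ) 1 :=
    hγ.continuousAt.eventually_mem
      (by simpa only [hγ0] using Metric.isOpen_ball.mem_nhds hz)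
  refine ge_of_tendsto h3 ?_
  filter_upwards [nhdsWithin_le_nhds hmem, self_mem_nhdsWithin] with t ht ht0
  have ht0' : (0 : ℝ) < t := ht0
  have h4 := hf.2 _ ht
  simp [hz'] at h4
  have h5 := nonneg_of_mul_nonneg_left h4 ht0'
  rw [slope_def_field, hγ0, hf.im_eq_zero hz hz', sub_zero, sub_zero]
  positivity

theorem TypicallyReal.monotoneOn_re {f : ℂ → ℂ} (hf : TypicallyReal f) :
    MonotoneOn (fun t : ℝ => (f t).re) (Set.Ioo (-1) 1) := by
  have hmem : ∀ t ∈ Set.Ioo (-1 : ℝ) 1, (t : ℂ) ∈ Metric.ball (0 : ℂ) 1 := by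
    intro t ht
    rw [mem_ball_zero_iff, Complex.norm_real, Real.norm_eq_abs]
    exact abs_lt.2 ht
  have hder : ∀ t ∈ Set.Ioo (-1 : ℝ) 1,
      HasDerivAt (fun t : ℝ => (f t).re) (deriv f t).re t := fun t ht =>
    (hf.1.differentiableAt (Metric.isOpen_ball.mem_nhds (hmem t ht))).hasDerivAt.real_of_complex
  refine monotoneOn_of_hasDerivWithinAt_nonneg (convex_Ioo _ _)
    (f' := fun t => (deriv f t).re)
    (fun t ht => (hder t ht).continuousAt.continuousWithinAt) (fun t ht => ?_) (fun t ht => ?_)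
  · rw [interior_Ioo] at ht
    exact (hder t ht).hasDerivWithinAt
  · rw [interior_Ioo] at ht
    exact hf.deriv_re_nonneg (hmem t ht) (by simp)

/-! ### Schwarz–Pick and the hyperbolic distance to the real diameter. -/

theorem mem_unitBall_iff_sq_lt {z : ℂ} :
    z ∈ Metric.ball (0 : ℂ) 1 ↔ z.re ^ 2 + z.im ^ 2 < 1 := by
  have h := Complex.sq_norm z
  rw [Complex.normSq_apply] at h
  rw [mem_ball_zero_iff]
  constructor
  · intro h1
    nlinarith [norm_nonneg z]
  · intro h1
    by_contra hneg
    push Not at hneg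
    nlinarith

theorem norm_sq_eq_re_im (z : ℂ) : ‖z‖ ^ 2 = z.re ^ 2 + z.im ^ 2 := by
  rw [Complex.sq_norm, Complex.normSq_apply]
  ring

theorem norm_sq_one_sub_mul_sub (t : ℝ) (z : ℂ) :
    ‖1 - t * z‖ ^ 2 - ‖z - t‖ ^ 2 = (1 - t ^ 2) * (1 - ‖z‖ ^ 2) := by
  simp only [norm_sq_eq_re_im]
  simp
  ring

theorem norm_sq_one_sub_mul_add (t : ℝ) (z : ℂ) :
    ‖1 - t * z‖ ^ 2 + ‖z - t‖ ^ 2 = (1 + t ^ 2) * (1 + ‖z‖ ^ 2) - 4 * t * z.re := by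
  simp only [norm_sq_eq_re_im]
  simp
  ring

theorem one_sub_real_mul_ne_zero {t : ℝ} (ht : t ^ 2 < 1) {z : ℂ}
    (hz : z ∈ Metric.ball (0 : ℂ) 1) : 1 - (t : ℂ) * z ≠ 0 := by
  intro h
  have h1 := norm_sq_one_sub_mul_sub t z
  rw [h, norm_zero, norm_sq_eq_re_im z] at h1
  have h2 := mem_unitBall_iff_sq_lt.1 hz
  nlinarith [sq_nonneg ‖z - t‖, mul_pos (sub_pos.2 ht) (sub_pos.2 h2)]

theorem real_moebius_mem_ball {t : ℝ} (ht : t ^ 2 < 1) {z : ℂ}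
    (hz : z ∈ Metric.ball (0 : ℂ) 1) : (z - t) / (1 - t * z) ∈ Metric.ball (0 : ℂ) 1 := by
  have h1 := norm_sq_one_sub_mul_sub t z
  have h2 := mem_unitBall_iff_sq_lt.1 hz
  rw [norm_sq_eq_re_im z] at h1
  have h3 := mul_pos (sub_pos.2 ht) (sub_pos.2 h2)
  rw [mem_ball_zero_iff, norm_div, div_lt_one (norm_pos_iff.2 (one_sub_real_mul_ne_zero ht hz))]
  exact lt_of_pow_lt_pow_left₀ 2 (norm_nonneg _) (by linarith)

/-- Schwarz–Pick for the pseudohyperbolic distance to real points. -/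
theorem schwarz_pick_real {f : ℂ → ℂ} (hf : DifferentiableOn ℂ f (Metric.ball 0 1))
    (hm : Set.MapsTo f (Metric.ball 0 1) (Metric.ball 0 1)) {t s : ℝ} (ht : t ^ 2 < 1)
    (hft : f t = s) {z : ℂ} (hz : z ∈ Metric.ball (0 : ℂ) 1) :
    ‖(f z - s) / (1 - s * f z)‖ ≤ ‖(z - t) / (1 - t * z)‖ := by
  have htb : (t : ℂ) ∈ Metric.ball (0 : ℂ) 1 := mem_unitBall_iff_sq_lt.2 (by simpa using ht)
  have hs : s ^ 2 < 1 := by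
    have := mem_unitBall_iff_sq_lt.1 (hm htb)
    simpa [hft] using this
  have ht' : (-t) ^ 2 < 1 := by simpa using ht
  have hmt : Set.MapsTo (fun ζ : ℂ => (ζ - ((-t : ℝ) : ℂ)) / (1 - ((-t : ℝ) : ℂ) * ζ))
      (Metric.ball 0 1) (Metric.ball 0 1) := fun ζ hζ => real_moebius_mem_ball ht' hζ
  have hms : Set.MapsTo (fun ζ : ℂ => (ζ - s) / (1 - s * ζ))
      (Metric.ball 0 1) (Metric.ball 0 1) := fun ζ hζ => real_moebius_mem_ball hs hζ
  have hdt : DifferentiableOn ℂ (fun ζ : ℂ => (ζ - ((-t : ℝ) : ℂ)) / (1 - ((-t : ℝ) : ℂ) * ζ))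
      (Metric.ball 0 1) :=
    DifferentiableOn.div (by fun_prop) (by fun_prop) fun ζ hζ => one_sub_real_mul_ne_zero ht' hζ
  have hds : DifferentiableOn ℂ (fun ζ : ℂ => (ζ - s) / (1 - s * ζ)) (Metric.ball 0 1) :=
    DifferentiableOn.div (by fun_prop) (by fun_prop) fun ζ hζ => one_sub_real_mul_ne_zero hs hζ
  have key := Complex.norm_le_norm_of_mapsTo_ball
    (hds.comp (hf.comp hdt hmt) (hm.comp hmt))
    ((hms.comp (hm.comp hmt)).mono_right Metric.ball_subset_closedBall)
    (by simp [hft])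
    (z := (z - t) / (1 - t * z)) (by simpa using real_moebius_mem_ball ht hz)
  have hinv : ((z - t) / (1 - t * z) - ((-t : ℝ) : ℂ)) /
      (1 - ((-t : ℝ) : ℂ) * ((z - t) / (1 - t * z))) = z := by
    have h1 := one_sub_real_mul_ne_zero ht hz
    have h2 : (1 - (t : ℂ) ^ 2) ≠ 0 := by
      exact_mod_cast (sub_pos.2 ht).ne'
    have h3 : 1 - ((-t : ℝ) : ℂ) * ((z - t) / (1 - t * z)) = (1 - t ^ 2) / (1 - t * z) := by
      rw [eq_div_iff h1, sub_mul, mul_assoc, div_mul_cancel₀ _ h1]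
      push_cast
      ring
    have h4 : (z - t) / (1 - t * z) - ((-t : ℝ) : ℂ) = z * (1 - t ^ 2) / (1 - t * z) := by
      rw [eq_div_iff h1, sub_mul, div_mul_cancel₀ _ h1]
      push_cast
      ring
    rw [h3, h4, div_div_div_cancel_right₀ h1, mul_div_cancel_right₀ _ h2]
  simpa only [Function.comp, hinv] using key

/-- `t` is the foot of the hyperbolic perpendicular from `z` to the real diameter; the equation is
the critical-point condition for the distance from `z` to `t`. -/
theorem exists_nearest_real {z : ℂ} (hz : z ∈ Metric.ball (0 : ℂ) 1) :
    ∃ t : ℝ, t ^ 2 < 1 ∧ (1 + t ^ 2) * (2 * z.re) = 2 * t * (1 + ‖z‖ ^ 2) := by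
  have h2 := mem_unitBall_iff_sq_lt.1 hz
  rw [norm_sq_eq_re_im]
  have hc : ContinuousOn (fun t : ℝ => 2 * t * (1 + (z.re ^ 2 + z.im ^ 2))
      - (1 + t ^ 2) * (2 * z.re)) (Set.Icc (-1) 1) := by fun_prop
  have hx1 : z.re < 1 := by nlinarith
  have hx2 : -1 < z.re := by nlinarith
  obtain ⟨t, ht, h0⟩ := intermediate_value_Ioo (by norm_num : (-1 : ℝ) ≤ 1) hc
    (show (0 : ℝ) ∈ Set.Ioo _ _ from ⟨by nlinarith, by nlinarith⟩)
  exact ⟨t, by nlinarith [ht.1, ht.2], by simp only at h0; linarith⟩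

/-- A self-map of the disc that is real on the real diameter does not increase the hyperbolic
distance to that diameter. -/
theorem im_mul_one_sub_norm_sq_le {f : ℂ → ℂ} (hf : DifferentiableOn ℂ f (Metric.ball 0 1))
    (hm : Set.MapsTo f (Metric.ball 0 1) (Metric.ball 0 1))
    (hreal : ∀ z ∈ Metric.ball (0 : ℂ) 1, z.im = 0 → (f z).im = 0) {z : ℂ}
    (hz : z ∈ Metric.ball (0 : ℂ) 1) :
    ((f z).im * (1 - ‖z‖ ^ 2)) ^ 2 ≤ (z.im * (1 - ‖f z‖ ^ 2)) ^ 2 := by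
  obtain ⟨t, ht, htz⟩ := exists_nearest_real hz
  have htb : (t : ℂ) ∈ Metric.ball (0 : ℂ) 1 := mem_unitBall_iff_sq_lt.2 (by simpa using ht)
  obtain ⟨s, hs⟩ : ∃ s : ℝ, f t = s :=
    ⟨(f t).re, Complex.ext rfl (by simp [hreal _ htb (by simp)])⟩
  have hs1 : s ^ 2 < 1 := by
    have := mem_unitBall_iff_sq_lt.1 (hm htb)
    simpa [hs] using this
  have hfz := hm hz
  have key := schwarz_pick_real hf hm ht hs hz
  rw [norm_div, norm_div, div_le_div_iff₀ (norm_pos_iff.2 (one_sub_real_mul_ne_zero hs1 hfz))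
    (norm_pos_iff.2 (one_sub_real_mul_ne_zero ht hz))] at key
  have key2 := pow_le_pow_left₀ (by positivity) key 2
  rw [mul_pow, mul_pow] at key2
  have e1 := norm_sq_one_sub_mul_sub t z
  have e2 := norm_sq_one_sub_mul_add t z
  have e3 := norm_sq_one_sub_mul_sub s (f z)
  have e4 := norm_sq_one_sub_mul_add s (f z)
  have hA : ‖z‖ ^ 2 < 1 := by
    rw [norm_sq_eq_re_im]
    exact mem_unitBall_iff_sq_lt.1 hz
  have hB : ‖f z‖ ^ 2 < 1 := by
    rw [norm_sq_eq_re_im]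
    exact mem_unitBall_iff_sq_lt.1 hfz
  have nz := norm_sq_eq_re_im z
  have nf := norm_sq_eq_re_im (f z)
  set A := ‖z‖ ^ 2
  set B := ‖f z‖ ^ 2
  set p := ‖z - t‖ ^ 2
  set q := ‖1 - t * z‖ ^ 2
  set p' := ‖f z - s‖ ^ 2
  set q' := ‖1 - s * f z‖ ^ 2
  have hN' : 0 ≤ q' + p' := by positivity
  have h1 : (q' + p') * (q - p) ≤ (q + p) * (q' - p') := by linarith
  have hD : 0 < (1 - t ^ 2) * (1 - A) := mul_pos (by linarith) (by linarith)
  have hD' : 0 < (1 - s ^ 2) * (1 - B) := mul_pos (by linarith) (by linarith)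
  have h2 := pow_le_pow_left₀ (mul_nonneg hN' (by rw [e1]; exact hD.le)) h1 2
  -- In general `(q + p)²` exceeds the right side by `((1 + t²) 2 Re z - 2 t (1 + A))²`, which is
  -- zero by the choice of `t`. For `s`, which need not be nearest to `f z`, the same identity still
  -- gives the inequality `h4`.
  have h3 : (q + p) ^ 2 = (1 - t ^ 2) ^ 2 * ((1 - A) ^ 2 + 4 * z.im ^ 2) := by
    have : 4 * z.im ^ 2 = 4 * A - (2 * z.re) ^ 2 := by rw [nz]; ring
    rw [e2, this]
    linear_combination ((1 + t ^ 2) * (2 * z.re) - 2 * t * (1 + A)) * htz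
  have h4 : (1 - s ^ 2) ^ 2 * ((1 - B) ^ 2 + 4 * (f z).im ^ 2) ≤ (q' + p') ^ 2 := by
    have : 4 * (f z).im ^ 2 = 4 * B - (2 * (f z).re) ^ 2 := by rw [nf]; ring
    rw [e4, this]
    linarith [sq_nonneg ((1 + s ^ 2) * (2 * (f z).re) - 2 * s * (1 + B))]
  rw [mul_pow, mul_pow, h3, e1, e3] at h2
  have h5 := (mul_le_mul_of_nonneg_right h4 (sq_nonneg ((1 - t ^ 2) * (1 - A)))).trans h2
  have hc : 0 < (1 - s ^ 2) ^ 2 * (1 - t ^ 2) ^ 2 :=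
    mul_pos (pow_pos (by linarith) _) (pow_pos (by linarith) _)
  have h6 : (1 - s ^ 2) ^ 2 * (1 - t ^ 2) ^ 2 * (((1 - B) ^ 2 + 4 * (f z).im ^ 2) * (1 - A) ^ 2) ≤
      (1 - s ^ 2) ^ 2 * (1 - t ^ 2) ^ 2 * (((1 - A) ^ 2 + 4 * z.im ^ 2) * (1 - B) ^ 2) := by
    linarith
  have h7 := le_of_mul_le_mul_left h6 hc
  rw [mul_pow, mul_pow]
  linarith

/-! ### The squared Cayley transform and its inverse. -/

/-- The typically real maps `h` of the disc into the slit plane with `h 0 = 1` and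
`h' 0 = 4 τ`: the squared Cayley transforms of the functions under study. -/
def slitTypicallyReal (τ : ℝ) : Set (ℂ → ℂ) :=
  {h | TypicallyReal h ∧ h 0 = 1 ∧ deriv h 0 = 4 * (τ : ℂ) ∧
    Set.MapsTo h (Metric.ball 0 1) Complex.slitPlane}

theorem one_sub_ne_zero_of_mem_ball {z : ℂ} (hz : z ∈ Metric.ball (0 : ℂ) 1) : 1 - z ≠ 0 := by
  intro h
  have h1 : z = 1 := by linear_combination -h
  simp [h1] at hz

theorem one_add_ne_zero_of_mem_ball {z : ℂ} (hz : z ∈ Metric.ball (0 : ℂ) 1) : 1 + z ≠ 0 := by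
  intro h
  have h1 : z = -1 := by linear_combination h
  simp [h1] at hz

theorem cayley_re {z : ℂ} :
    ((1 + z) / (1 - z)).re = (1 - ‖z‖ ^ 2) / Complex.normSq (1 - z) := by
  rw [Complex.div_re, norm_sq_eq_re_im]
  simp
  ring

theorem cayley_im {z : ℂ} : ((1 + z) / (1 - z)).im = 2 * z.im / Complex.normSq (1 - z) := by
  rw [Complex.div_im]
  simp
  ring

theorem cayley_re_pos {z : ℂ} (hz : z ∈ Metric.ball (0 : ℂ) 1) : 0 < ((1 + z) / (1 - z)).re := by
  rw [cayley_re, norm_sq_eq_re_im]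
  exact div_pos (sub_pos.2 (mem_unitBall_iff_sq_lt.1 hz))
    (Complex.normSq_pos.2 (one_sub_ne_zero_of_mem_ball hz))

theorem sq_mem_slitPlane {p : ℂ} (hp : 0 < p.re) : p ^ 2 ∈ Complex.slitPlane := by
  rw [Complex.mem_slitPlane_iff]
  rcases eq_or_ne p.im 0 with h | h
  · left
    rw [pow_two, Complex.mul_re, h]
    nlinarith
  · right
    rw [pow_two, Complex.mul_im]
    have := mul_ne_zero hp.ne' h
    intro h2
    exact this (by linarith)

theorem hasDerivAt_zero_of_mem {f : ℂ → ℂ} {τ : ℝ} (hf : TypicallyReal f)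
    (hd : deriv f 0 = (τ : ℂ)) : HasDerivAt f τ 0 :=
  hd ▸ hf.differentiableAt_zero.hasDerivAt

theorem cayley_sq_mem {f : ℂ → ℂ} {τ : ℝ} (hf : f ∈ boundedTypicallyRealWithDeriv τ) :
    (fun z => ((1 + f z) / (1 - f z)) ^ 2) ∈ slitTypicallyReal τ := by
  obtain ⟨⟨ht, hm, h0, -, -⟩, hd⟩ := hf
  have hne : ∀ z ∈ Metric.ball (0 : ℂ) 1, 1 - f z ≠ 0 := fun z hz =>
    one_sub_ne_zero_of_mem_ball (hm hz)
  refine ⟨⟨(((ht.1.const_add 1).div (ht.1.const_sub 1) hne).pow 2), fun z hz => ?_⟩,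
    by simp [h0], ?_, fun z hz => sq_mem_slitPlane (cayley_re_pos (hm hz))⟩
  · have h1 := cayley_re_pos (hm hz)
    have h2 := ht.2 z hz
    have h3 : 0 ≤ ((1 + f z) / (1 - f z)).im * z.im := by
      rw [cayley_im, div_mul_eq_mul_div]
      exact div_nonneg (by linarith) (Complex.normSq_nonneg _)
    simp only [pow_two, Complex.mul_im]
    have := mul_nonneg h1.le h3
    linarith
  · have h1 := hasDerivAt_zero_of_mem ht hd
    have := ((h1.const_add 1).fun_div (h1.const_sub 1) (by simp [h0])).fun_pow 2
    rw [this.deriv]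
    simp [h0]
    ring

theorem sqrt_re_pos {w : ℂ} (hw : w ∈ Complex.slitPlane) : 0 < (Complex.sqrt w).re := by
  rw [Complex.sqrt, Complex.cpow_inv_two_re, Real.sqrt_pos]
  have h1 : -w.re ≤ ‖w‖ := (neg_le_abs _).trans (Complex.abs_re_le_norm w)
  rcases Complex.mem_slitPlane_iff.1 hw with h | h
  · have := norm_nonneg w
    linarith
  · have h2 := norm_sq_eq_re_im w
    have h3 : 0 < w.im ^ 2 := by positivity
    have h4 : -w.re ≠ ‖w‖ := by
      intro h5
      rw [← h5] at h2
      nlinarith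
    have := lt_of_le_of_ne h1 h4
    linarith

theorem sqrt_sq_eq (w : ℂ) : Complex.sqrt w ^ 2 = w := Complex.cpow_ofNat_inv_pow w 2

theorem sqrt_of_sq {p : ℂ} (hp : 0 < p.re) : Complex.sqrt (p ^ 2) = p := Complex.sq_cpow_two_inv hp

theorem sqrt_add_one_ne_zero {w : ℂ} (hw : w ∈ Complex.slitPlane) : Complex.sqrt w + 1 ≠ 0 := by
  intro h
  have := congrArg Complex.re h
  simp at this
  linarith [sqrt_re_pos hw]

theorem sqrt_transform_mem {h : ℂ → ℂ} {τ : ℝ} (hτ : 0 < τ) (hh : h ∈ slitTypicallyReal τ) :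
    (fun z => (Complex.sqrt (h z) - 1) / (Complex.sqrt (h z) + 1)) ∈
      boundedTypicallyRealWithDeriv τ := by
  obtain ⟨ht, h0, hd, hm⟩ := hh
  have hs : DifferentiableOn ℂ (fun z => Complex.sqrt (h z)) (Metric.ball 0 1) :=
    Complex.differentiableOn_sqrt.comp ht.1 hm
  have hderiv : deriv (fun z => (Complex.sqrt (h z) - 1) / (Complex.sqrt (h z) + 1)) 0 = τ := by
    have h1 : HasDerivAt h (4 * (τ : ℂ)) 0 := hd ▸ ht.differentiableAt_zero.hasDerivAt
    have h2 : HasDerivAt (fun z => Complex.sqrt (h z)) (2 * (τ : ℂ)) 0 := by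
      have h3 : HasDerivAt Complex.sqrt (1 / 2) (h 0) := by
        rw [h0]
        simpa using Complex.hasDerivAt_sqrt Complex.one_mem_slitPlane
      exact (HasDerivAt.comp (0 : ℂ) h3 h1).congr_deriv (by ring)
    have h3 := (h2.sub_const 1).fun_div (h2.add_const 1)
      (by simp only [h0, Complex.sqrt_one]; norm_num)
    rw [h3.deriv]
    simp only [h0, Complex.sqrt_one]
    ring
  refine ⟨⟨⟨(hs.sub_const 1).div (hs.add_const 1) fun z hz => sqrt_add_one_ne_zero (hm hz),
    fun z hz => ?_⟩, fun z hz => ?_, by simp [h0], by simp [hderiv], by simpa [hderiv]⟩, hderiv⟩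
  · have hp := sqrt_re_pos (hm hz)
    have h1 := ht.2 z hz
    rw [← sqrt_sq_eq (h z), pow_two, Complex.mul_im] at h1
    have h2 : 0 ≤ (Complex.sqrt (h z)).im * z.im := by
      by_contra hneg
      push Not at hneg
      nlinarith
    have h3 : ((Complex.sqrt (h z) - 1) / (Complex.sqrt (h z) + 1)).im =
        2 * (Complex.sqrt (h z)).im / Complex.normSq (Complex.sqrt (h z) + 1) := by
      rw [Complex.div_im]
      simp
      ring
    rw [h3, div_mul_eq_mul_div]
    exact div_nonneg (by linarith) (Complex.normSq_nonneg _)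
  · have hp := sqrt_re_pos (hm hz)
    rw [mem_ball_zero_iff, norm_div,
      div_lt_one (norm_pos_iff.2 (sqrt_add_one_ne_zero (hm hz)))]
    refine lt_of_pow_lt_pow_left₀ 2 (norm_nonneg _) ?_
    rw [norm_sq_eq_re_im, norm_sq_eq_re_im]
    simp
    nlinarith

theorem sqrt_transform_cayley_sq {f : ℂ} (hf : f ∈ Metric.ball (0 : ℂ) 1) :
    (Complex.sqrt (((1 + f) / (1 - f)) ^ 2) - 1) / (Complex.sqrt (((1 + f) / (1 - f)) ^ 2) + 1)
      = f := by
  have h1 := one_sub_ne_zero_of_mem_ball hf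
  rw [sqrt_of_sq (cayley_re_pos hf)]
  field_simp
  ring

theorem cayley_sq_sqrt_transform {w : ℂ} (hw : w ∈ Complex.slitPlane) :
    ((1 + (Complex.sqrt w - 1) / (Complex.sqrt w + 1)) /
      (1 - (Complex.sqrt w - 1) / (Complex.sqrt w + 1))) ^ 2 = w := by
  have h1 := sqrt_add_one_ne_zero hw
  have h2 : (1 + (Complex.sqrt w - 1) / (Complex.sqrt w + 1)) /
      (1 - (Complex.sqrt w - 1) / (Complex.sqrt w + 1)) = Complex.sqrt w := by
    field_simp
    ring
  rw [h2, sqrt_sq_eq]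

theorem valueRegion_eq_image {z₀ : ℂ} (hz₀ : z₀ ∈ Metric.ball (0 : ℂ) 1) {τ : ℝ} (hτ : 0 < τ) :
    valueRegion (boundedTypicallyRealWithDeriv τ) z₀ =
      (fun w : ℂ => (Complex.sqrt w - 1) / (Complex.sqrt w + 1)) ''
        valueRegion (slitTypicallyReal τ) z₀ := by
  ext w
  constructor
  · rintro ⟨f, hf, rfl⟩
    exact ⟨_, ⟨_, cayley_sq_mem hf, rfl⟩, sqrt_transform_cayley_sq (hf.1.2.1 hz₀)⟩
  · rintro ⟨_, ⟨h, hh, rfl⟩, rfl⟩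
    exact ⟨_, sqrt_transform_mem hτ hh, rfl⟩

/-! ### The typically real function behind the second disc. -/

/-- Subordination to the squared Cayley transform of the identity. -/
theorem typicallyReal_one_sub_cayley_quotient {f : ℂ → ℂ} {τ : ℝ}
    (hf : f ∈ boundedTypicallyRealWithDeriv τ) :
    TypicallyReal fun z => 1 - ((1 + f z) * (1 - z) / ((1 - f z) * (1 + z))) ^ 2 := by
  obtain ⟨⟨ht, hm, h0, -, -⟩, hd⟩ := hf
  have hne : ∀ z ∈ Metric.ball (0 : ℂ) 1, (1 - f z) * (1 + z) ≠ 0 := fun z hz =>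
    mul_ne_zero (one_sub_ne_zero_of_mem_ball (hm hz)) (one_add_ne_zero_of_mem_ball hz)
  refine ⟨((((ht.1.const_add 1).mul (by fun_prop)).div ((ht.1.const_sub 1).mul (by fun_prop))
    hne).pow 2).const_sub 1, fun z hz => ?_⟩
  have h1 := im_mul_one_sub_norm_sq_le ht.1 hm (fun z hz => ht.im_eq_zero hz) hz
  have h2 := ht.2 z hz
  have hA : 0 < 1 - ‖z‖ ^ 2 := by
    rw [norm_sq_eq_re_im]
    linarith [mem_unitBall_iff_sq_lt.1 hz]
  have hB : 0 < 1 - ‖f z‖ ^ 2 := by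
    rw [norm_sq_eq_re_im]
    linarith [mem_unitBall_iff_sq_lt.1 (hm hz)]
  have hN := Complex.normSq_pos.2 (hne z hz)
  -- `Re q > 0`, and the comparison of distances to the real diameter gives `Im q · Im z ≤ 0`; hence
  -- `-Im q² = -2 Re q Im q` has the sign of `Im z`.
  set q := (1 + f z) * (1 - z) / ((1 - f z) * (1 + z)) with hq
  have hre : q.re = ((1 - ‖f z‖ ^ 2) * (1 - ‖z‖ ^ 2) + 4 * ((f z).im * z.im)) /
      Complex.normSq ((1 - f z) * (1 + z)) := by
    rw [hq, Complex.div_re, norm_sq_eq_re_im, norm_sq_eq_re_im]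
    simp only [Complex.mul_re, Complex.mul_im, Complex.add_re, Complex.sub_re, Complex.add_im,
      Complex.sub_im, Complex.one_re, Complex.one_im]
    ring
  have him : q.im = 2 * ((f z).im * (1 - ‖z‖ ^ 2) - z.im * (1 - ‖f z‖ ^ 2)) /
      Complex.normSq ((1 - f z) * (1 + z)) := by
    rw [hq, Complex.div_im, norm_sq_eq_re_im, norm_sq_eq_re_im]
    simp only [Complex.mul_re, Complex.mul_im, Complex.add_re, Complex.sub_re, Complex.add_im,
      Complex.sub_im, Complex.one_re, Complex.one_im]
    ring
  have hre' : 0 < q.re := by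
    rw [hre]
    exact div_pos (by nlinarith [mul_pos hA hB]) hN
  have him' : 0 ≤ -q.im * z.im := by
    rw [him, ← neg_div, div_mul_eq_mul_div]
    refine div_nonneg ?_ hN.le
    have h3 := sq_le_sq.1 h1
    rw [abs_mul, abs_mul, abs_of_pos hA, abs_of_pos hB] at h3
    have h4 : |(f z).im| * |z.im| = (f z).im * z.im := by rw [← abs_mul, abs_of_nonneg h2]
    have h5 : |z.im| * |z.im| = z.im * z.im := abs_mul_abs_self _
    have h6 := mul_le_mul_of_nonneg_right h3 (abs_nonneg z.im)
    nlinarith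
  rw [Complex.sub_im, Complex.one_im, pow_two, Complex.mul_im]
  nlinarith

theorem deriv_one_sub_cayley_quotient {f : ℂ → ℂ} {τ : ℝ}
    (hf : f ∈ boundedTypicallyRealWithDeriv τ) :
    deriv (fun z => 1 - ((1 + f z) * (1 - z) / ((1 - f z) * (1 + z))) ^ 2) 0
      = ((4 * (1 - τ) : ℝ) : ℂ) := by
  obtain ⟨⟨ht, hm, h0, -, -⟩, hd⟩ := hf
  have h1 := hasDerivAt_zero_of_mem ht hd
  have hid := hasDerivAt_id' (0 : ℂ)
  have := ((((h1.const_add 1).fun_mul (hid.const_sub 1)).fun_div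
    ((h1.const_sub 1).fun_mul (hid.const_add 1)) (by simp [h0])).fun_pow 2).const_sub 1
  rw [this.deriv]
  simp [h0]
  ring

/-! ### Convexity of the slit class. -/

/-- Here `s` plays the role of `Im z`: both points lie in the same closed half-plane, so a proper
combination is real only if both are real, hence both positive. -/
theorem combo_mem_slitPlane {u v : ℂ} (hu : u ∈ Complex.slitPlane) (hv : v ∈ Complex.slitPlane)
    {s : ℝ} (hus : 0 ≤ u.im * s) (hvs : 0 ≤ v.im * s) (hs : s = 0 → u.im = 0 ∧ v.im = 0)
    {a b : ℝ} (ha : 0 ≤ a) (hb : 0 ≤ b) (hab : a + b = 1) :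
    (a : ℂ) * u + b * v ∈ Complex.slitPlane := by
  rcases ha.eq_or_lt with rfl | ha
  · have : b = 1 := by linarith
    simpa [this] using hv
  rcases hb.eq_or_lt with rfl | hb
  · have : a = 1 := by linarith
    simpa [this] using hu
  rw [Complex.mem_slitPlane_iff] at hu hv ⊢
  have him : ((a : ℂ) * u + b * v).im = a * u.im + b * v.im := by simp
  have hre : ((a : ℂ) * u + b * v).re = a * u.re + b * v.re := by simp
  rw [him, hre]
  by_cases h : u.im = 0 ∧ v.im = 0
  · left
    have h1 := hu.resolve_right (fun h' => h' h.1)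
    have h2 := hv.resolve_right (fun h' => h' h.2)
    positivity
  · right
    have hs0 : s ≠ 0 := fun h' => h (hs h')
    intro h0
    have h1 : a * (u.im * s) + b * (v.im * s) = 0 := by linear_combination s * h0
    have h2 := mul_nonneg ha.le hus
    have h3 := mul_nonneg hb.le hvs
    have h4 : a * (u.im * s) = 0 := by linarith
    have h5 : b * (v.im * s) = 0 := by linarith
    apply h
    constructor
    · simpa [ha.ne', hs0] using h4
    · simpa [hb.ne', hs0] using h5

theorem convex_valueRegion_slitTypicallyReal {z₀ : ℂ} {τ : ℝ} :
    Convex ℝ (valueRegion (slitTypicallyReal τ) z₀) := by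
  rintro _ ⟨g, ⟨hg, hg0, hgd, hgm⟩, rfl⟩ _ ⟨h, ⟨hh, hh0, hhd, hhm⟩, rfl⟩ a b ha hb hab
  refine ⟨fun z => (a : ℂ) * g z + b * h z, ⟨(hg.const_mul ha).add (hh.const_mul hb), ?_, ?_,
    fun z hz => ?_⟩, by simp⟩
  · simp only [hg0, hh0, mul_one]
    exact_mod_cast hab
  · have := (hg.differentiableAt_zero.hasDerivAt.const_mul (a : ℂ)).fun_add
      (hh.differentiableAt_zero.hasDerivAt.const_mul (b : ℂ))
    rw [this.deriv, hgd, hhd, ← add_mul]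
    have h1 : (a + b : ℂ) = 1 := by exact_mod_cast hab
    rw [h1, one_mul]
  · exact combo_mem_slitPlane (hgm hz) (hhm hz) (hg.2 z hz) (hh.2 z hz)
      (fun h => ⟨hg.im_eq_zero hz h, hh.im_eq_zero hz h⟩) ha hb hab

/-! ### Functions whose values trace the two arcs. -/

theorem robertson_denom_pos {t y : ℝ} (ht : t ∈ Set.Ioo (-1 : ℝ) 1)
    (hy : y ∈ Set.Icc (-1 : ℝ) 1) : 0 < 1 - 2 * y * t + t ^ 2 := by
  obtain ⟨h1, h2⟩ := ht
  obtain ⟨h3, h4⟩ := hy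
  have h5 : 0 < (1 + t) ^ 2 := by nlinarith
  have h6 : 0 < (1 - t) ^ 2 := by nlinarith
  rcases le_or_gt y 0 with h0 | h0
  · nlinarith [mul_pos h5 (by linarith : 0 < 1 - y), mul_nonneg h6.le (by linarith : 0 ≤ 1 + y)]
  · nlinarith [mul_pos h6 (by linarith : 0 < 1 + y), mul_nonneg h5.le (by linarith : 0 ≤ 1 - y)]

theorem re_mem_Ioo_of_mem_ball {z : ℂ} (hz : z ∈ Metric.ball (0 : ℂ) 1) :
    z.re ∈ Set.Ioo (-1 : ℝ) 1 := by
  have := mem_unitBall_iff_sq_lt.1 hz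
  constructor <;> nlinarith

theorem TypicallyReal.const_add {f : ℂ → ℂ} (hf : TypicallyReal f) (c : ℝ) :
    TypicallyReal fun z => (c : ℂ) + f z :=
  ⟨hf.1.const_add _, fun z hz => by simpa using hf.2 z hz⟩

/-- The witness is `1 + 4 τ k` with `k = z / (1 - 2 y z + z²)`. On the real diameter its numerator
is a quadratic of the same shape with `y - 2 τ` for `y`, positive because `y ≥ 2 τ - 1` gives `y - 2
τ ≥ -1`. -/
theorem firstArc_subset_valueRegion {z₀ : ℂ} {τ : ℝ}
    (hτ : τ ∈ Set.Ioc (0 : ℝ) 1) : firstArc z₀ τ ⊆ valueRegion (slitTypicallyReal τ) z₀ := by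
  rintro _ ⟨y, hy, rfl⟩
  obtain ⟨hτ0, hτ1⟩ := hτ
  have hy' : y ∈ Set.Icc (-1 : ℝ) 1 := ⟨by linarith [hy.1], hy.2⟩
  refine ⟨fun z => ((1 : ℝ) : ℂ) + ((4 * τ : ℝ) : ℂ) * (z / (1 - 2 * (y : ℂ) * z + z ^ 2)),
    ⟨((typicallyReal_robertson hy').const_mul (by positivity)).const_add 1, by simp, ?_,
      fun z hz => ?_⟩, ?_⟩
  · rw [(((hasDerivAt_robertson y).const_mul _).const_add _).deriv]
    simp
  · rw [Complex.mem_slitPlane_iff]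
    rcases eq_or_ne z.im 0 with h | h
    · left
      obtain ⟨t, rfl⟩ : ∃ t : ℝ, z = t := ⟨z.re, Complex.ext rfl (by simp [h])⟩
      have ht : t ∈ Set.Ioo (-1 : ℝ) 1 := re_mem_Ioo_of_mem_ball hz
      have h1 := robertson_denom_pos ht hy'
      have h2 := robertson_denom_pos ht (y := y - 2 * τ) ⟨by linarith [hy.1], by linarith [hy.2]⟩
      have h3 : 1 + 4 * τ * (t / (1 - 2 * y * t + t ^ 2)) =
          (1 - 2 * (y - 2 * τ) * t + t ^ 2) / (1 - 2 * y * t + t ^ 2) := by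
        rw [eq_div_iff h1.ne', add_mul, mul_assoc (4 * τ), div_mul_cancel₀ _ h1.ne']
        ring
      have h4 : ((1 : ℝ) : ℂ) + ((4 * τ : ℝ) : ℂ) * (t / (1 - 2 * (y : ℂ) * t + t ^ 2)) =
          ((1 + 4 * τ * (t / (1 - 2 * y * t + t ^ 2)) : ℝ) : ℂ) := by
        push_cast
        ring
      simp only [h4, Complex.ofReal_re, h3]
      positivity
    · right
      have := im_robertson_mul_im_pos hz hy' h
      rw [Complex.add_im, Complex.ofReal_im, Complex.im_ofReal_mul]
      intro h0
      have h1 : (z / (1 - 2 * (y : ℂ) * z + z ^ 2)).im = 0 := by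
        have : (4 * τ) ≠ 0 := by positivity
        simpa [this, hτ0.ne'] using h0
      simp [h1] at this
  · push_cast
    rw [mul_div_assoc]

theorem secondArc_subset_valueRegion {z₀ : ℂ} (hz₀ : z₀ ∈ Metric.ball (0 : ℂ) 1) {τ : ℝ}
    (hτ : τ ∈ Set.Ioo (0 : ℝ) 1) : secondArc z₀ τ ⊆ valueRegion (slitTypicallyReal τ) z₀ := by
  rintro _ ⟨x, hx, rfl⟩
  obtain ⟨hτ0, hτ1⟩ := hτ
  have hx1 : 0 < 1 - x := by linarith [hx.2]
  have hx' : x ∈ Set.Icc (-1 : ℝ) 1 := ⟨hx.1, by linarith⟩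
  have hone : (1 : ℝ) ∈ Set.Icc (-1 : ℝ) 1 := by simp
  -- In `1 + p k_x + q k_1`, with `k_y = z / (1 - 2 y z + z²)`, the derivative forces `p + q = 4 τ`,
  -- and `p` is chosen to produce the factor `(z + 1)²` in the numerator. Then `q ≥ 0` amounts to `x
  -- ≤ 2 τ - 1`.
  set p : ℝ := 4 * (1 - τ) * (1 + x) / (1 - x) with hp
  set q : ℝ := 4 * τ - p with hq
  have hpnn : 0 ≤ p := div_nonneg (mul_nonneg (by linarith) (by linarith [hx.1])) hx1.le
  have hqeq : q = 4 * (2 * τ - 1 - x) / (1 - x) := by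
    rw [hq, hp]
    field_simp
    ring
  have hqnn : 0 ≤ q := by
    rw [hqeq]
    exact div_nonneg (by linarith [hx.2]) hx1.le
  have hformula : ∀ z ∈ Metric.ball (0 : ℂ) 1,
      ((1 : ℝ) : ℂ) + ((p : ℂ) * (z / (1 - 2 * (x : ℂ) * z + z ^ 2)) +
        (q : ℂ) * (z / (1 - 2 * ((1 : ℝ) : ℂ) * z + z ^ 2))) =
      (z + 1) ^ 2 * (1 + z * (-4 + 4 * (τ : ℂ) - 2 * (x : ℂ) + z)) /
        ((z - 1) ^ 2 * (1 - 2 * (x : ℂ) * z + z ^ 2)) := by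
    intro z hz
    have h1 := robertson_denom_ne_zero hz hx'
    have h2 : z - 1 ≠ 0 := by
      rw [← neg_sub]
      exact neg_ne_zero.2 (one_sub_ne_zero_of_mem_ball hz)
    have h3 : (1 - x : ℂ) ≠ 0 := by exact_mod_cast hx1.ne'
    have h4 : 1 - 2 * ((1 : ℝ) : ℂ) * z + z ^ 2 = (z - 1) ^ 2 := by
      push_cast
      ring
    rw [h4, hqeq, hp]
    push_cast
    obtain ⟨D, hD⟩ : ∃ D : ℂ, D = 1 - 2 * (x : ℂ) * z + z ^ 2 := ⟨_, rfl⟩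
    rw [← hD] at h1 ⊢
    field_simp
    rw [hD]
    ring
  refine ⟨fun z => ((1 : ℝ) : ℂ) + ((p : ℂ) * (z / (1 - 2 * (x : ℂ) * z + z ^ 2)) +
        (q : ℂ) * (z / (1 - 2 * ((1 : ℝ) : ℂ) * z + z ^ 2))),
    ⟨(((typicallyReal_robertson hx').const_mul hpnn).add
      ((typicallyReal_robertson hone).const_mul hqnn)).const_add 1, by simp, ?_,
      fun z hz => ?_⟩, hformula z₀ hz₀⟩
  · rw [((((hasDerivAt_robertson x).const_mul _).fun_add
      ((hasDerivAt_robertson 1).const_mul _)).const_add _).deriv, hq]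
    push_cast
    ring
  · rw [Complex.mem_slitPlane_iff]
    rcases eq_or_ne z.im 0 with h | h
    · left
      obtain ⟨t, rfl⟩ : ∃ t : ℝ, z = t := ⟨z.re, Complex.ext rfl (by simp [h])⟩
      have ht : t ∈ Set.Ioo (-1 : ℝ) 1 := re_mem_Ioo_of_mem_ball hz
      have h1 := robertson_denom_pos ht hx'
      have h2 := robertson_denom_pos ht (y := x + 2 - 2 * τ)
        ⟨by linarith [hx.1], by linarith [hx.2]⟩
      have h3 : (t + 1 : ℂ) ^ 2 * (1 + t * (-4 + 4 * (τ : ℂ) - 2 * (x : ℂ) + t)) /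
          ((t - 1) ^ 2 * (1 - 2 * (x : ℂ) * t + t ^ 2)) =
          (((t + 1) ^ 2 * (1 - 2 * (x + 2 - 2 * τ) * t + t ^ 2) /
            ((t - 1) ^ 2 * (1 - 2 * x * t + t ^ 2)) : ℝ) : ℂ) := by
        push_cast
        ring
      have h4 : 0 < (t + 1) ^ 2 := by nlinarith [ht.1]
      have h5 : 0 < (t - 1) ^ 2 := by nlinarith [ht.2]
      simp only [hformula _ hz, h3, Complex.ofReal_re]
      positivity
    · right
      have h1 := im_robertson_mul_im_pos hz hx' h
      have h2 := im_robertson_mul_im_pos hz hone h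
      rw [Complex.add_im, Complex.ofReal_im, Complex.add_im, Complex.im_ofReal_mul,
        Complex.im_ofReal_mul, zero_add]
      intro h0
      have h3 : p * ((z / (1 - 2 * (x : ℂ) * z + z ^ 2)).im * z.im) +
          q * ((z / (1 - 2 * ((1 : ℝ) : ℂ) * z + z ^ 2)).im * z.im) = 0 := by
        linear_combination z.im * h0
      have h4 := mul_nonneg hpnn h1.le
      have h5 := mul_nonneg hqnn h2.le
      have hpz : p = 0 := by
        have : p * ((z / (1 - 2 * (x : ℂ) * z + z ^ 2)).im * z.im) = 0 := by linarith
        exact (mul_eq_zero.1 this).resolve_right h1.ne'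
      have hqz : q = 0 := by
        have : q * ((z / (1 - 2 * ((1 : ℝ) : ℂ) * z + z ^ 2)).im * z.im) = 0 := by linarith
        exact (mul_eq_zero.1 this).resolve_right h2.ne'
      linarith

theorem arcs_at_one {z₀ : ℂ} (hz₀ : z₀ ∈ Metric.ball (0 : ℂ) 1) :
    firstArc z₀ 1 = {((z₀ + 1) / (z₀ - 1)) ^ 2} ∧ secondArc z₀ 1 = {((z₀ + 1) / (z₀ - 1)) ^ 2} := by
  have h2 : z₀ - 1 ≠ 0 := by
    rw [← neg_sub]
    exact neg_ne_zero.2 (one_sub_ne_zero_of_mem_ball hz₀)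
  constructor
  · have : Set.Icc (2 * (1 : ℝ) - 1) 1 = {1} := by norm_num
    rw [firstArc, this, Set.image_singleton]
    congr 1
    have h4 : 1 - 2 * ((1 : ℝ) : ℂ) * z₀ + z₀ ^ 2 = (z₀ - 1) ^ 2 := by
      push_cast
      ring
    rw [h4]
    push_cast
    field_simp
    ring
  · have key : ∀ x ∈ Set.Icc (-1 : ℝ) (2 * 1 - 1),
        (z₀ + 1) ^ 2 * (1 + z₀ * (-4 + 4 * ((1 : ℝ) : ℂ) - 2 * (x : ℂ) + z₀)) /
        ((z₀ - 1) ^ 2 * (1 - 2 * (x : ℂ) * z₀ + z₀ ^ 2)) = ((z₀ + 1) / (z₀ - 1)) ^ 2 := by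
      intro x hx
      have h1 := robertson_denom_ne_zero hz₀ (y := x) ⟨hx.1, by linarith [hx.2]⟩
      have h3 : 1 + z₀ * (-4 + 4 * ((1 : ℝ) : ℂ) - 2 * (x : ℂ) + z₀) =
          1 - 2 * (x : ℂ) * z₀ + z₀ ^ 2 := by
        push_cast
        ring
      rw [h3, div_pow, mul_div_mul_right _ _ h1]
    ext w
    constructor
    · rintro ⟨x, hx, rfl⟩
      exact key x hx
    · rintro rfl
      exact ⟨-1, ⟨le_rfl, by norm_num⟩, key (-1) ⟨le_rfl, by norm_num⟩⟩

theorem arcs_subset_valueRegion {z₀ : ℂ} (hz₀ : z₀ ∈ Metric.ball (0 : ℂ) 1) {τ : ℝ}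
    (hτ : τ ∈ Set.Ioc (0 : ℝ) 1) :
    firstArc z₀ τ ∪ secondArc z₀ τ ⊆ valueRegion (slitTypicallyReal τ) z₀ := by
  refine Set.union_subset (firstArc_subset_valueRegion hτ) ?_
  -- For `τ = 1` the parameter `x = 1` is allowed and the weight `p` loses its meaning, but both
  -- arcs are then the same point.
  rcases hτ.2.eq_or_lt with rfl | h
  · rw [(arcs_at_one hz₀).2, ← (arcs_at_one hz₀).1]
    exact firstArc_subset_valueRegion hτ
  · exact secondArc_subset_valueRegion hz₀ ⟨hτ.1, h⟩

theorem valueRegion_slitTypicallyReal_subset_slitPlane {z₀ : ℂ}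
    (hz₀ : z₀ ∈ Metric.ball (0 : ℂ) 1) {τ : ℝ} :
    valueRegion (slitTypicallyReal τ) z₀ ⊆ Complex.slitPlane := by
  rintro _ ⟨h, hh, rfl⟩
  exact hh.2.2.2 hz₀

/-! ### Real base points. -/

open Filter Topology in
/-- For real `t`, the value `h t` of a function of the class is one of the values of the
first arc. -/
theorem valueRegion_subset_firstArc_of_real {z₀ : ℂ} (hz₀ : z₀ ∈ Metric.ball (0 : ℂ) 1)
    (hz₀' : z₀ ≠ 0) (him : z₀.im = 0) {τ : ℝ} (hτ : 0 < τ) :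
    valueRegion (slitTypicallyReal τ) z₀ ⊆ firstArc z₀ τ := by
  rintro _ ⟨h, ⟨ht, h0, hd, hm⟩, rfl⟩
  obtain ⟨x, rfl⟩ : ∃ x : ℝ, z₀ = x := ⟨z₀.re, Complex.ext rfl (by simp [him])⟩
  have hx : x ∈ Set.Ioo (-1 : ℝ) 1 := re_mem_Ioo_of_mem_ball hz₀
  have hmem : ∀ t ∈ Set.Ioo (-1 : ℝ) 1, (t : ℂ) ∈ Metric.ball (0 : ℂ) 1 := by
    intro t ht
    rw [mem_ball_zero_iff, Complex.norm_real, Real.norm_eq_abs]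
    exact abs_lt.2 ht
  set g : ℂ → ℂ := fun z => ((-1 : ℝ) : ℂ) + h z with hg
  have hgt : TypicallyReal g := ht.const_add (-1)
  have hg0 : g 0 = 0 := by simp [hg, h0]
  have hgd : deriv g 0 = ((4 * τ : ℝ) : ℂ) := by
    rw [hg, deriv_const_add, hd]
    simp
  have hσ : 0 < 4 * τ := by positivity
  have hσ' : 0 < (deriv g 0).re := by simpa [hgd]
  have hreal : ∀ t ∈ Set.Ioo (-1 : ℝ) 1, g t = ((g t).re : ℂ) := fun t htm =>
    Complex.ext rfl (by simp [hgt.im_eq_zero (hmem t htm) (by simp)])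
  have hsign : ∀ t ∈ Set.Ioo (-1 : ℝ) 1, t ≠ 0 → 0 < (g t).re / t := by
    intro t htm ht0
    have h1 := hgt.re_mul_dslope_pos hg0 hσ' (hmem t htm)
    have h2 : dslope g 0 t = (((g t).re / t : ℝ) : ℂ) := by
      have h3 := mul_dslope_zero hg0 (t : ℂ)
      have h4 : (t : ℂ) ≠ 0 := by exact_mod_cast ht0
      push_cast
      rw [← hreal t htm, ← h3]
      field_simp
    have h3 : (1 - (t : ℂ) ^ 2) * dslope g 0 t = (((1 - t ^ 2) * ((g t).re / t) : ℝ) : ℂ) := by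
      rw [h2]
      push_cast
      ring
    rw [h3, Complex.ofReal_re] at h1
    exact (mul_pos_iff_of_pos_left (by nlinarith [htm.1, htm.2])).1 h1
  have hlow : ∀ t ∈ Set.Ioo (-1 : ℝ) 1, -1 < (g t).re := by
    intro t htm
    have h1 := hm (hmem t htm)
    have h2 : (h t).im = 0 := ht.im_eq_zero (hmem t htm) (by simp)
    have h3 := (Complex.mem_slitPlane_iff.1 h1).resolve_right (fun h' => h' h2)
    simp [hg]
    linarith
  have hH : ∀ t ∈ Set.Ioo (-1 : ℝ) 1, t ≠ 0 →
      (reciprocalDefect g t).re = t + 1 / t - 4 * τ / (g t).re := by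
    intro t htm ht0
    rw [reciprocalDefect_eq hgt hg0 hσ' (hmem t htm) (by exact_mod_cast ht0), hgd, hreal t htm]
    norm_cast
  have hmono := (hgt.reciprocalDefect hg0 hgd hσ).monotoneOn_re
  -- Solving `x + 1 / x - 4 τ / g x = 2 y` for `g x` gives the first-arc formula. The range of `y`
  -- follows from monotonicity: near `1`, `g > 0` bounds the defect by `t + 1 / t → 2`; near `-1`,
  -- `-1 < g < 0` bounds it below by `4 τ + t + 1 / t → 4 τ - 2`.
  set y : ℝ := (reciprocalDefect g x).re / 2 with hy
  have hy1 : 2 * y ≤ 2 := by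
    have hc : ContinuousAt (fun t : ℝ => t + 1 / t) 1 :=
      continuousAt_id.add (continuousAt_const.div continuousAt_id (by simp))
    have hlim : Tendsto (fun t : ℝ => t + 1 / t) (𝓝[<] (1 : ℝ)) (𝓝 2) := by
      have := (hc.tendsto.mono_left nhdsWithin_le_nhds : Tendsto _ (𝓝[<] (1 : ℝ)) _)
      norm_num at this
      simpa using this
    refine ge_of_tendsto hlim ?_
    filter_upwards [Ioo_mem_nhdsLT (max_lt hx.2 zero_lt_one)] with t htm
    have h1 : x < t := (le_max_left _ _).trans_lt htm.1
    have h2 : 0 < t := (le_max_right _ _).trans_lt htm.1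
    have htI : t ∈ Set.Ioo (-1 : ℝ) 1 := ⟨by linarith, htm.2⟩
    have h3 := hmono hx htI h1.le
    simp only [hH t htI h2.ne'] at h3
    have h4 : 0 < (g t).re := by
      have := mul_pos (hsign t htI h2.ne') h2
      rwa [div_mul_cancel₀ _ h2.ne'] at this
    have h5 : 0 < 4 * τ / (g t).re := by positivity
    rw [hy]
    linarith
  have hy2 : 4 * τ - 2 ≤ 2 * y := by
    have hc : ContinuousAt (fun t : ℝ => 4 * τ + (t + 1 / t)) (-1) :=
      continuousAt_const.add (continuousAt_id.add (continuousAt_const.div continuousAt_id (by simp)))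
    have hlim : Tendsto (fun t : ℝ => 4 * τ + (t + 1 / t)) (𝓝[>] (-1 : ℝ)) (𝓝 (4 * τ - 2)) := by
      have := (hc.tendsto.mono_left nhdsWithin_le_nhds : Tendsto _ (𝓝[>] (-1 : ℝ)) _)
      convert this using 2
      norm_num
      ring
    refine le_of_tendsto hlim ?_
    filter_upwards [Ioo_mem_nhdsGT (lt_min hx.1 (by norm_num : (-1 : ℝ) < 0))] with t htm
    have h1 : t < x := htm.2.trans_le (min_le_left _ _)
    have h2 : t < 0 := htm.2.trans_le (min_le_right _ _)
    have htI : t ∈ Set.Ioo (-1 : ℝ) 1 := ⟨htm.1, by linarith⟩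
    have h3 := hmono htI hx h1.le
    simp only [hH t htI h2.ne] at h3
    have h4 : (g t).re < 0 := by
      have := mul_neg_of_pos_of_neg (hsign t htI h2.ne) h2
      rwa [div_mul_cancel₀ _ h2.ne] at this
    have h5 : 4 * τ / (g t).re ≤ -(4 * τ) := by
      rw [div_le_iff_of_neg h4]
      nlinarith [hlow t htI]
    rw [hy]
    linarith
  have hx0 : x ≠ 0 := by
    rintro rfl
    simp at hz₀'
  refine ⟨y, ⟨by linarith, by linarith⟩, ?_⟩
  have hgx : (g x).re ≠ 0 := by
    intro h'
    have := hsign x hx hx0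
    rw [h'] at this
    simp at this
  have hden : 0 < 1 - 2 * y * x + x ^ 2 :=
    robertson_denom_pos hx ⟨by linarith, by linarith⟩
  have h2y : 2 * y = x + 1 / x - 4 * τ / (g x).re := by
    rw [hy, ← hH x hx hx0]
    ring
  have hval : 4 * τ * x / (1 - 2 * y * x + x ^ 2) = (g x).re := by
    rw [div_eq_iff hden.ne', h2y]
    field_simp
    ring
  have hhx : h x = 1 + g x := by
    simp [hg]
  simp only []
  rw [hhx, hreal x hx, ← hval]
  push_cast
  ring

/-! ### Circles and discs through the origin. -/

theorem norm_sub_half_mul_I_sq (u : ℂ) (c : ℝ) :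
    ‖u - ((c / 2 : ℝ) : ℂ) * Complex.I‖ ^ 2 = ‖u‖ ^ 2 - c * u.im + (|c| / 2) ^ 2 := by
  rw [norm_sq_eq_re_im, norm_sq_eq_re_im, div_pow, sq_abs]
  simp
  ring

theorem mem_closedBall_half_mul_I {u : ℂ} {c : ℝ} :
    u ∈ Metric.closedBall (((c / 2 : ℝ) : ℂ) * Complex.I) (|c| / 2) ↔ ‖u‖ ^ 2 ≤ c * u.im := by
  have h := norm_sub_half_mul_I_sq u c
  rw [mem_closedBall_iff_norm, ← pow_le_pow_iff_left₀ (norm_nonneg _) (by positivity) two_ne_zero,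
    h]
  constructor <;> intro h <;> linarith

theorem mem_sphere_half_mul_I {u : ℂ} {c : ℝ} :
    u ∈ Metric.sphere (((c / 2 : ℝ) : ℂ) * Complex.I) (|c| / 2) ↔ ‖u‖ ^ 2 = c * u.im := by
  have h := norm_sub_half_mul_I_sq u c
  rw [mem_sphere_iff_norm, ← pow_left_inj₀ (norm_nonneg _) (by positivity) two_ne_zero,
    h]
  constructor <;> intro h <;> linarith

theorem frontier_closedBall_inter_closedBall (c₁ c₂ : ℂ) {r₁ r₂ : ℝ} (h₁ : r₁ ≠ 0) (h₂ : r₂ ≠ 0) :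
    frontier (Metric.closedBall c₁ r₁ ∩ Metric.closedBall c₂ r₂) =
      (Metric.sphere c₁ r₁ ∩ Metric.closedBall c₂ r₂) ∪
        (Metric.closedBall c₁ r₁ ∩ Metric.sphere c₂ r₂) := by
  rw [(Metric.isClosed_closedBall.inter Metric.isClosed_closedBall).frontier_eq, interior_inter,
    interior_closedBall _ h₁, interior_closedBall _ h₂]
  ext w
  simp only [Set.mem_sdiff, Set.mem_inter_iff, Set.mem_union, Metric.mem_closedBall,
    Metric.mem_ball, Metric.mem_sphere]
  constructor
  · rintro ⟨⟨h1, h2⟩, h3⟩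
    rcases h1.eq_or_lt with h | h
    · exact Or.inl ⟨h, h2⟩
    · exact Or.inr ⟨h1, le_antisymm h2 (not_lt.1 fun h' => h3 ⟨h, h'⟩)⟩
  · rintro (⟨h1, h2⟩ | ⟨h1, h2⟩)
    · exact ⟨⟨h1.le, h2⟩, fun h => h.1.ne h1⟩
    · exact ⟨⟨h1, h2.le⟩, fun h => h.2.ne h2⟩

/-- Points of the circle `‖u‖² = -(c / Im a) Im u` other than the origin are of the form
`c / (a - 2 y)` with real `y`. -/
theorem exists_eq_div_of_norm_sq_eq {a u : ℂ} (ha : a.im ≠ 0) {c : ℝ} (hu : u ≠ 0)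
    (h : ‖u‖ ^ 2 = -(c / a.im) * u.im) : ∃ y : ℝ, u = c / (a - 2 * y) := by
  have hn : ‖u‖ ^ 2 ≠ 0 := pow_ne_zero _ (norm_ne_zero_iff.2 hu)
  have him : ((c : ℂ) / u).im = a.im := by
    rw [div_eq_mul_inv, Complex.im_ofReal_mul, Complex.inv_im, Complex.normSq_eq_norm_sq]
    rw [mul_div_assoc', div_eq_iff hn, h]
    field_simp
  have hcu : (c : ℂ) / u ≠ 0 := by
    intro h0
    rw [h0] at him
    exact ha (by simpa using him.symm)
  refine ⟨(a.re - ((c : ℂ) / u).re) / 2, ?_⟩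
  have h1 : a - 2 * (((a.re - ((c : ℂ) / u).re) / 2 : ℝ) : ℂ) = c / u := by
    apply Complex.ext
    · simp
      ring
    · rw [him]
      simp
  have hc : (c : ℂ) ≠ 0 := fun h0 => hcu (by simp [h0])
  rw [h1]
  field_simp

theorem norm_sq_div_sub_eq {a : ℂ} (ha : a.im ≠ 0) (c y : ℝ) :
    ‖(c : ℂ) / (a - 2 * y)‖ ^ 2 = -(c / a.im) * ((c : ℂ) / (a - 2 * y)).im := by
  have h1 : a - 2 * (y : ℂ) ≠ 0 := fun h => ha (by simpa using congrArg Complex.im h)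
  have h2 : Complex.normSq (a - 2 * y) ≠ 0 := fun h => h1 (Complex.normSq_eq_zero.1 h)
  have h3 : (a - 2 * (y : ℂ)).im = a.im := by simp
  rw [norm_div, Complex.norm_real, div_pow, Real.norm_eq_abs, sq_abs, Complex.sq_norm,
    div_eq_mul_inv (c : ℂ), Complex.im_ofReal_mul, Complex.inv_im, h3]
  field_simp

/-- The inversion `u ↦ c / u` turns the disc into a half-plane, where membership can be read off
from an imaginary part. -/
theorem norm_sq_le_iff {a u : ℂ} {c : ℝ} (hu : u ≠ 0) :
    ‖u‖ ^ 2 ≤ -(c / a.im) * u.im ↔ 1 ≤ ((c : ℂ) / u).im / a.im := by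
  have hn : 0 < ‖u‖ ^ 2 := pow_pos (norm_pos_iff.2 hu) 2
  have him : ((c : ℂ) / u).im / a.im = (-(c / a.im) * u.im) / ‖u‖ ^ 2 := by
    rw [div_eq_mul_inv (c : ℂ), Complex.im_ofReal_mul, Complex.inv_im, Complex.normSq_eq_norm_sq]
    ring
  rw [him, le_div_iff₀ hn, one_mul]

/-- Only `R / (a - b)` can change the ratio from `1`, and it does so by `-R / |a - b|²`. Together
with `sub_mul_sub_div_eq` this reduces disc membership to the sign of a real product. -/
theorem nonpos_of_one_le_im_div {a : ℂ} (ha : a.im ≠ 0) {r R b : ℝ}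
    (h : 1 ≤ (a + r + R / (a - b)).im / a.im) : R ≤ 0 := by
  have h1 : a - (b : ℂ) ≠ 0 := fun h => ha (by simpa using congrArg Complex.im h)
  have h2 : 0 < Complex.normSq (a - b) := Complex.normSq_pos.2 h1
  have h3 : (a + r + R / (a - b)).im / a.im = 1 - R / Complex.normSq (a - b) := by
    rw [div_eq_mul_inv (R : ℂ)]
    simp only [Complex.add_im, Complex.ofReal_im, Complex.im_ofReal_mul, Complex.inv_im,
      Complex.sub_im]
    field_simp
    ring
  rw [h3] at h
  have h4 : R / Complex.normSq (a - b) ≤ 0 := by linarith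
  by_contra hR
  push Not at hR
  have := div_pos hR h2
  linarith

theorem sub_mul_sub_div_eq {a : ℂ} {b : ℝ} (h : a - (b : ℂ) ≠ 0) (e y : ℝ) :
    (a - e) * (a - 2 * y) / (a - b) =
      a + ((b - e - 2 * y : ℝ) : ℂ) + (((b - e) * (b - 2 * y) : ℝ) : ℂ) / (a - b) := by
  rw [div_eq_iff h, add_mul, div_mul_cancel₀ _ h]
  push_cast
  ring

/-! ### Which part of each circle lies in the other disc. -/

section Lens

variable {a : ℂ} {τ : ℝ}

/-- Inverting a point of the first circle relative to the second disc yields `(a + 2) (a - 2 y) / (a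
- b)`. Its residue at `b` must be nonpositive, and is a positive multiple of `(y - (2 τ - 1)) (y -
1)`. -/
theorem mem_Icc_of_mem_second_disc (ha : a.im ≠ 0) (hτ : τ ∈ Set.Ioo (0 : ℝ) 1) {y : ℝ}
    (h : ‖1 - (1 + ((4 * τ : ℝ) : ℂ) / (a - 2 * y)) / ((a + 2) / (a - 2))‖ ^ 2 ≤
      -(4 * (1 - τ) / a.im) *
        (1 - (1 + ((4 * τ : ℝ) : ℂ) / (a - 2 * y)) / ((a + 2) / (a - 2))).im) :
    y ∈ Set.Icc (2 * τ - 1) 1 := by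
  obtain ⟨hτ0, hτ1⟩ := hτ
  have hne : ∀ r : ℝ, a - (r : ℂ) ≠ 0 := fun r h => ha (by simpa using congrArg Complex.im h)
  have h1 : a - 2 * (y : ℂ) ≠ 0 := by simpa using hne (2 * y)
  have h2 : a - 2 ≠ 0 := by simpa using hne 2
  have h3 : a + 2 ≠ 0 := by simpa using hne (-2)
  have hτ' : 0 < 1 - τ := by linarith
  -- The zero, as a polynomial in `a`, of the numerator of `1 - w / M`.
  set b : ℝ := 2 * (y - τ) / (1 - τ) with hb
  have hbne := hne b
  have hτc : (1 - τ : ℂ) ≠ 0 := by exact_mod_cast hτ'.ne'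
  have hV : 1 - (1 + ((4 * τ : ℝ) : ℂ) / (a - 2 * y)) / ((a + 2) / (a - 2)) =
      4 * (1 - τ) * (a - b) / ((a + 2) * (a - 2 * y)) := by
    rw [hb]
    push_cast
    field_simp
    ring
  have hV0 : 4 * (1 - τ) * (a - b) / ((a + 2) * (a - 2 * y)) ≠ 0 :=
    div_ne_zero (mul_ne_zero (mul_ne_zero (by norm_num) hτc) hbne) (mul_ne_zero h3 h1)
  rw [hV, norm_sq_le_iff hV0] at h
  have h4 : ((4 * (1 - τ) : ℝ) : ℂ) / (4 * (1 - τ) * (a - b) / ((a + 2) * (a - 2 * y))) =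
      (a - ((-2 : ℝ) : ℂ)) * (a - 2 * y) / (a - b) := by
    push_cast
    field_simp
    ring
  rw [h4, sub_mul_sub_div_eq hbne] at h
  have h5 := nonpos_of_one_le_im_div ha h
  have h6 : (b - -2) * (b - 2 * y) = 4 * τ * ((y - (2 * τ - 1)) * (y - 1)) / (1 - τ) ^ 2 := by
    rw [hb]
    field_simp
    ring
  rw [h6, div_nonpos_iff] at h5
  have h7 : (y - (2 * τ - 1)) * (y - 1) ≤ 0 := by
    have h8 : 0 < (1 - τ) ^ 2 := by positivity
    rcases h5 with h5 | h5
    · linarith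
    · nlinarith
  constructor
  · by_contra hn
    push Not at hn
    nlinarith
  · by_contra hn
    push Not at hn
    nlinarith

/-- The parametrization `c / (a - 2 y)` misses the origin, which is `w = 1` on the first circle, so
that point is excluded separately; the inverted ratio is `1 - τ < 1`. -/
theorem one_notMem_second_disc (ha : a.im ≠ 0) (hτ : τ ∈ Set.Ioo (0 : ℝ) 1) :
    ¬ ‖1 - 1 / ((a + 2) / (a - 2))‖ ^ 2 ≤
      -(4 * (1 - τ) / a.im) * (1 - 1 / ((a + 2) / (a - 2))).im := by
  obtain ⟨hτ0, hτ1⟩ := hτ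
  have hne : ∀ r : ℝ, a - (r : ℂ) ≠ 0 := fun r h => ha (by simpa using congrArg Complex.im h)
  have h2 : a - 2 ≠ 0 := by simpa using hne 2
  have h3 : a + 2 ≠ 0 := by simpa using hne (-2)
  have hV : 1 - 1 / ((a + 2) / (a - 2)) = 4 / (a + 2) := by
    field_simp
    ring
  rw [hV, norm_sq_le_iff (div_ne_zero (by norm_num) h3)]
  have h4 : ((4 * (1 - τ) : ℝ) : ℂ) / (4 / (a + 2)) = ((1 - τ : ℝ) : ℂ) * (a + 2) := by
    push_cast
    field_simp
  rw [h4, Complex.im_ofReal_mul]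
  have h5 : (a + 2).im = a.im := by simp
  rw [h5, mul_div_cancel_right₀ _ ha]
  linarith

theorem mem_Icc_of_mem_first_disc (ha : a.im ≠ 0) (hτ : τ ∈ Set.Ioo (0 : ℝ) 1) {x : ℝ}
    (h : ‖(a + 2) / (a - 2) * (1 - ((4 * (1 - τ) : ℝ) : ℂ) / (a - 2 * x)) - 1‖ ^ 2 ≤
      -(4 * τ / a.im) *
        ((a + 2) / (a - 2) * (1 - ((4 * (1 - τ) : ℝ) : ℂ) / (a - 2 * x)) - 1).im) :
    x ∈ Set.Icc (-1) (2 * τ - 1) := by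
  obtain ⟨hτ0, hτ1⟩ := hτ
  have hne : ∀ r : ℝ, a - (r : ℂ) ≠ 0 := fun r h => ha (by simpa using congrArg Complex.im h)
  have h1 : a - 2 * (x : ℂ) ≠ 0 := by simpa using hne (2 * x)
  have h2 : a - 2 ≠ 0 := by simpa using hne 2
  set b : ℝ := 2 * (x + 1 - τ) / τ with hb
  have hbne := hne b
  have hτc : (τ : ℂ) ≠ 0 := by exact_mod_cast hτ0.ne'
  have hV : (a + 2) / (a - 2) * (1 - ((4 * (1 - τ) : ℝ) : ℂ) / (a - 2 * x)) - 1 =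
      4 * τ * (a - b) / ((a - 2) * (a - 2 * x)) := by
    rw [hb]
    push_cast
    field_simp
    ring
  have hV0 : 4 * τ * (a - b) / ((a - 2) * (a - 2 * x)) ≠ 0 :=
    div_ne_zero (mul_ne_zero (mul_ne_zero (by norm_num) hτc) hbne) (mul_ne_zero h2 h1)
  rw [hV, norm_sq_le_iff hV0] at h
  have h4 : ((4 * τ : ℝ) : ℂ) / (4 * τ * (a - b) / ((a - 2) * (a - 2 * x))) =
      (a - ((2 : ℝ) : ℂ)) * (a - 2 * x) / (a - b) := by
    push_cast
    field_simp
  rw [h4, sub_mul_sub_div_eq hbne] at h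
  have h5 := nonpos_of_one_le_im_div ha h
  have h6 : (b - 2) * (b - 2 * x) = 4 * (1 - τ) * ((x - (2 * τ - 1)) * (x + 1)) / τ ^ 2 := by
    rw [hb]
    field_simp
    ring
  rw [h6, div_nonpos_iff] at h5
  have h7 : (x - (2 * τ - 1)) * (x + 1) ≤ 0 := by
    have h8 : 0 < τ ^ 2 := by positivity
    rcases h5 with h5 | h5
    · linarith
    · nlinarith
  constructor
  · by_contra hn
    push Not at hn
    nlinarith
  · by_contra hn
    push Not at hn
    nlinarith

/-- The point of the second circle missed by its parametrization is `w = M`; here the inverted ratio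
is `τ < 1`. -/
theorem notMem_first_disc (ha : a.im ≠ 0) (hτ : τ ∈ Set.Ioo (0 : ℝ) 1) :
    ¬ ‖(a + 2) / (a - 2) - 1‖ ^ 2 ≤ -(4 * τ / a.im) * ((a + 2) / (a - 2) - 1).im := by
  obtain ⟨hτ0, hτ1⟩ := hτ
  have hne : ∀ r : ℝ, a - (r : ℂ) ≠ 0 := fun r h => ha (by simpa using congrArg Complex.im h)
  have h2 : a - 2 ≠ 0 := by simpa using hne 2
  have hV : (a + 2) / (a - 2) - 1 = 4 / (a - 2) := by
    field_simp
    ring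
  rw [hV, norm_sq_le_iff (div_ne_zero (by norm_num) h2)]
  have h4 : ((4 * τ : ℝ) : ℂ) / (4 / (a - 2)) = (τ : ℂ) * (a - 2) := by
    push_cast
    field_simp
  rw [h4, Complex.im_ofReal_mul]
  have h5 : (a - 2).im = a.im := by simp
  rw [h5, mul_div_cancel_right₀ _ ha]
  linarith

end Lens

/-! ### The arcs and the discs in terms of `a = z + 1 / z`. -/

theorem add_one_div_im_ne_zero {z : ℂ} (hz : z ∈ Metric.ball (0 : ℂ) 1) (hz' : z.im ≠ 0) :
    (z + 1 / z).im ≠ 0 := by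
  have hz0 : z ≠ 0 := by
    rintro rfl
    simp at hz'
  have h1 : 0 < ‖z‖ := norm_pos_iff.2 hz0
  have h2 : ‖z‖ < 1 := by simpa using hz
  rw [im_add_one_div]
  refine mul_ne_zero hz' (ne_of_lt ?_)
  rw [sub_neg, lt_div_iff₀ (by positivity)]
  nlinarith

theorem robertson_denom_eq {z : ℂ} (hz0 : z ≠ 0) (y : ℝ) :
    1 - 2 * (y : ℂ) * z + z ^ 2 = z * (z + 1 / z - 2 * y) := by
  field_simp
  ring

theorem add_two_div_sub_two {z : ℂ} (hz0 : z ≠ 0) :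
    (z + 1 / z + 2) / (z + 1 / z - 2) = ((z + 1) / (z - 1)) ^ 2 := by
  have h1 : z + 1 / z + 2 = (z + 1) ^ 2 / z := by
    field_simp
    ring
  have h2 : z + 1 / z - 2 = (z - 1) ^ 2 / z := by
    field_simp
    ring
  rw [h1, h2, div_div_div_cancel_right₀ hz0, div_pow]

theorem firstArc_eq_image {z : ℂ} (hz0 : z ≠ 0) (τ : ℝ) :
    firstArc z τ =
      (fun y : ℝ => 1 + ((4 * τ : ℝ) : ℂ) / (z + 1 / z - 2 * y)) '' Set.Icc (2 * τ - 1) 1 := by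
  refine Set.image_congr fun y hy => ?_
  rw [robertson_denom_eq hz0, mul_comm z, mul_div_mul_right _ _ hz0]
  push_cast
  rfl

theorem secondArc_eq_image {z : ℂ} (hz : z ∈ Metric.ball (0 : ℂ) 1) (hz0 : z ≠ 0) {τ : ℝ}
    (hτ : τ ≤ 1) :
    secondArc z τ = (fun x : ℝ => (z + 1 / z + 2) / (z + 1 / z - 2) *
      (1 - ((4 * (1 - τ) : ℝ) : ℂ) / (z + 1 / z - 2 * x))) '' Set.Icc (-1) (2 * τ - 1) := by
  refine Set.image_congr fun x hx => ?_
  have h1 := robertson_denom_ne_zero hz (y := x) ⟨hx.1, by linarith [hx.2]⟩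
  rw [robertson_denom_eq hz0] at h1
  have h2 := right_ne_zero_of_mul h1
  have h3 : 1 + z * (-4 + 4 * (τ : ℂ) - 2 * (x : ℂ) + z) =
      z * (z + 1 / z - 2 * x - ((4 * (1 - τ) : ℝ) : ℂ)) := by
    push_cast
    field_simp
    ring
  rw [robertson_denom_eq hz0, add_two_div_sub_two hz0, h3, mul_div_mul_comm, div_pow,
    mul_div_mul_left _ _ hz0, sub_div, div_self h2]

theorem mem_closedBall_one_add {w p : ℂ} {r : ℝ} :
    w ∈ Metric.closedBall (1 + p) r ↔ w - 1 ∈ Metric.closedBall p r := by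
  rw [mem_closedBall_iff_norm, mem_closedBall_iff_norm, sub_sub]

theorem mem_sphere_one_add {w p : ℂ} {r : ℝ} :
    w ∈ Metric.sphere (1 + p) r ↔ w - 1 ∈ Metric.sphere p r := by
  rw [mem_sphere_iff_norm, mem_sphere_iff_norm, sub_sub]

theorem norm_sub_sub_mul {M : ℂ} (hM : M ≠ 0) (w p : ℂ) :
    ‖w - (M - M * p)‖ = ‖M‖ * ‖1 - w / M - p‖ := by
  rw [← norm_mul, ← norm_neg]
  congr 1
  field_simp
  ring

theorem mem_closedBall_sub_mul {M : ℂ} (hM : M ≠ 0) {w p : ℂ} {r : ℝ} :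
    w ∈ Metric.closedBall (M - M * p) (‖M‖ * r) ↔ 1 - w / M ∈ Metric.closedBall p r := by
  rw [mem_closedBall_iff_norm, mem_closedBall_iff_norm, norm_sub_sub_mul hM,
    mul_le_mul_iff_right₀ (norm_pos_iff.2 hM)]

theorem mem_sphere_sub_mul {M : ℂ} (hM : M ≠ 0) {w p : ℂ} {r : ℝ} :
    w ∈ Metric.sphere (M - M * p) (‖M‖ * r) ↔ 1 - w / M ∈ Metric.sphere p r := by
  rw [mem_sphere_iff_norm, mem_sphere_iff_norm, norm_sub_sub_mul hM,
    mul_right_inj' (norm_ne_zero_iff.2 hM)]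

theorem TypicallyReal.norm_sq_le_div {f : ℂ → ℂ} (hf : TypicallyReal f) (h0 : f 0 = 0)
    {σ : ℝ} (hd : deriv f 0 = σ) (hσ : 0 ≤ σ) {z : ℂ}
    (hz : z ∈ Metric.ball (0 : ℂ) 1) (hz' : z.im ≠ 0) :
    ‖f z‖ ^ 2 ≤ -(σ / (z + 1 / z).im) * (f z).im := by
  have hz0 : z ≠ 0 := by
    rintro rfl
    simp at hz'
  have h1 := hf.norm_sq_le h0 hd hσ hz hz0
  have h2 : ‖z‖ < 1 := by simpa using hz
  have hn : 0 < ‖z‖ := norm_pos_iff.2 hz0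
  have h3 : 0 < 1 / ‖z‖ ^ 2 - 1 := by
    rw [sub_pos, lt_div_iff₀ (by positivity)]
    nlinarith
  have h4 : -(σ / (z + 1 / z).im) * (f z).im =
      σ * ((f z).im * z.im) / (z.im ^ 2 * (1 / ‖z‖ ^ 2 - 1)) := by
    rw [im_add_one_div, ← neg_sub (1 / ‖z‖ ^ 2) 1]
    generalize 1 / ‖z‖ ^ 2 - 1 = s at h3
    field_simp
  rw [h4, le_div_iff₀ (by positivity)]
  linarith

/-- The values at `z` lie in two closed discs. -/
theorem norm_sq_le_of_mem_valueRegion {z : ℂ} (hz : z ∈ Metric.ball (0 : ℂ) 1) (hz' : z.im ≠ 0)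
    {τ : ℝ} (hτ : τ ∈ Set.Ioc (0 : ℝ) 1) {w : ℂ}
    (hw : w ∈ valueRegion (slitTypicallyReal τ) z) :
    ‖w - 1‖ ^ 2 ≤ -(4 * τ / (z + 1 / z).im) * (w - 1).im ∧
    ‖1 - w / ((z + 1 / z + 2) / (z + 1 / z - 2))‖ ^ 2 ≤ -(4 * (1 - τ) / (z + 1 / z).im) *
      (1 - w / ((z + 1 / z + 2) / (z + 1 / z - 2))).im := by
  obtain ⟨hτ0, hτ1⟩ := hτ
  have hz0 : z ≠ 0 := by
    rintro rfl
    simp at hz'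
  obtain ⟨h, hh, rfl⟩ := hw
  constructor
  · obtain ⟨ht, h0, hd, -⟩ := hh
    have h1 := (ht.const_add (-1)).norm_sq_le_div (by simp [h0]) (σ := 4 * τ)
      (by rw [deriv_const_add, hd]; simp) (by positivity) hz hz'
    have h2 : ((-1 : ℝ) : ℂ) + h z = h z - 1 := by
      push_cast
      ring
    simpa only [h2] using h1
  -- Schwarz–Pick concerns self-maps of the disc, so the estimate goes through the inverse transform
  -- of `h`.
  · have hf := sqrt_transform_mem hτ0 hh
    have h1 := (typicallyReal_one_sub_cayley_quotient hf).norm_sq_le_div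
      (by simp [hh.2.1]) (deriv_one_sub_cayley_quotient hf) (by linarith) hz hz'
    have h2 : 1 - ((1 + (Complex.sqrt (h z) - 1) / (Complex.sqrt (h z) + 1)) * (1 - z) /
        ((1 - (Complex.sqrt (h z) - 1) / (Complex.sqrt (h z) + 1)) * (1 + z))) ^ 2 =
        1 - h z / ((z + 1 / z + 2) / (z + 1 / z - 2)) := by
      rw [add_two_div_sub_two hz0, mul_div_mul_comm, mul_pow,
        cayley_sq_sqrt_transform (hh.2.2.2 hz), div_eq_mul_inv (h z), ← inv_pow, inv_div]
      congr 2
      rw [div_pow, div_pow]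
      congr 1 <;> ring
    simpa only [h2] using h1

theorem firstArc_subset_sphere {z : ℂ} (hz : z ∈ Metric.ball (0 : ℂ) 1) (hz' : z.im ≠ 0) (τ : ℝ) :
    firstArc z τ ⊆ Metric.sphere
      (1 + ((-(4 * τ / (z + 1 / z).im) / 2 : ℝ) : ℂ) * Complex.I)
      (|-(4 * τ / (z + 1 / z).im)| / 2) := by
  have hz0 : z ≠ 0 := by
    rintro rfl
    simp at hz'
  rw [firstArc_eq_image hz0]
  rintro _ ⟨y, -, rfl⟩
  rw [mem_sphere_one_add, mem_sphere_half_mul_I, add_sub_cancel_left]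
  exact norm_sq_div_sub_eq (add_one_div_im_ne_zero hz hz') _ _

theorem add_two_div_sub_two_ne_zero {a : ℂ} (ha : a.im ≠ 0) : (a + 2) / (a - 2) ≠ 0 := by
  refine div_ne_zero (fun h => ha ?_) (fun h => ha ?_)
  · simpa using congrArg Complex.im h
  · simpa using congrArg Complex.im h

theorem secondArc_subset_sphere {z : ℂ} (hz : z ∈ Metric.ball (0 : ℂ) 1) (hz' : z.im ≠ 0) {τ : ℝ}
    (hτ : τ ≤ 1) :
    secondArc z τ ⊆ Metric.sphere
      ((z + 1 / z + 2) / (z + 1 / z - 2) - (z + 1 / z + 2) / (z + 1 / z - 2) *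
        (((-(4 * (1 - τ) / (z + 1 / z).im) / 2 : ℝ) : ℂ) * Complex.I))
      (‖(z + 1 / z + 2) / (z + 1 / z - 2)‖ * (|-(4 * (1 - τ) / (z + 1 / z).im)| / 2)) := by
  have hz0 : z ≠ 0 := by
    rintro rfl
    simp at hz'
  have ha := add_one_div_im_ne_zero hz hz'
  have hM := add_two_div_sub_two_ne_zero ha
  rw [secondArc_eq_image hz hz0 hτ]
  rintro _ ⟨x, -, rfl⟩
  rw [mem_sphere_sub_mul hM, mem_sphere_half_mul_I, mul_div_cancel_left₀ _ hM, sub_sub_cancel]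
  exact norm_sq_div_sub_eq ha _ _

/-! ### The value region is the lens. -/

/-- The value region of the slit class is a compact set bounded by the two arcs. -/
theorem valueRegion_slitTypicallyReal_compact_frontier {z : ℂ} (hz : z ∈ Metric.ball (0 : ℂ) 1)
    (hz0 : z ≠ 0) {τ : ℝ} (hτ : τ ∈ Set.Ioc (0 : ℝ) 1) :
    IsCompact (valueRegion (slitTypicallyReal τ) z) ∧
      frontier (valueRegion (slitTypicallyReal τ) z) = firstArc z τ ∪ secondArc z τ := by
  have harcs := arcs_subset_valueRegion hz hτ
  obtain ⟨hτ0, hτ1⟩ := hτ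
  by_cases hz' : z.im = 0
  · have hsub := valueRegion_subset_firstArc_of_real hz hz0 hz' hτ0
    have heq : valueRegion (slitTypicallyReal τ) z = firstArc z τ ∪ secondArc z τ :=
      (hsub.trans Set.subset_union_left).antisymm harcs
    have heq' : valueRegion (slitTypicallyReal τ) z = firstArc z τ :=
      hsub.antisymm (Set.subset_union_left.trans harcs)
    have hcomp : IsCompact (valueRegion (slitTypicallyReal τ) z) := by
      rw [heq']
      refine isCompact_Icc.image_of_continuousOn ?_
      refine continuousOn_const.add (ContinuousOn.div (by fun_prop) (by fun_prop) fun y hy => ?_)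
      exact robertson_denom_ne_zero hz ⟨by linarith [hy.1], hy.2⟩
    refine ⟨hcomp, ?_⟩
    -- The value region lies on the real line, so it has empty interior and is its own frontier.
    have hint : interior (valueRegion (slitTypicallyReal τ) z) = ∅ := by
      have hline : valueRegion (slitTypicallyReal τ) z ⊆ Complex.im ⁻¹' {0} := by
        rintro _ ⟨h, hh, rfl⟩
        exact hh.1.im_eq_zero hz hz'
      have h1 := interior_mono hline
      rwa [Complex.interior_preimage_im, interior_singleton, Set.preimage_empty,
        Set.subset_empty_iff] at h1
    rw [hcomp.isClosed.frontier_eq, hint, Set.sdiff_empty, heq]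
  · have ha := add_one_div_im_ne_zero hz hz'
    have hM := add_two_div_sub_two_ne_zero ha
    have hbound := fun w (hw : w ∈ valueRegion (slitTypicallyReal τ) z) =>
      norm_sq_le_of_mem_valueRegion hz hz' ⟨hτ0, hτ1⟩ hw
    have hs1 := firstArc_subset_sphere hz hz' τ
    have hs2 := secondArc_subset_sphere hz hz' hτ1
    rcases hτ1.eq_or_lt with rfl | hτ1
    · obtain ⟨h1, h2⟩ := arcs_at_one hz
      rw [h1, h2, Set.union_self] at harcs ⊢
      have heq : valueRegion (slitTypicallyReal 1) z = {((z + 1) / (z - 1)) ^ 2} := by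
        refine Set.Subset.antisymm (fun w hw => ?_) harcs
        -- For `τ = 1` the second disc has radius zero, which forces `w = M`.
        have h3 := (hbound w hw).2
        rw [sub_self, mul_zero, zero_div, neg_zero, zero_mul] at h3
        have h4 : 1 - w / ((z + 1 / z + 2) / (z + 1 / z - 2)) = 0 := by
          rw [← norm_eq_zero]
          exact pow_eq_zero_iff two_ne_zero |>.1 (le_antisymm h3 (sq_nonneg _))
        rw [Set.mem_singleton_iff, ← add_two_div_sub_two hz0]
        exact (div_eq_one_iff_eq hM).1 (sub_eq_zero.1 h4).symm
      rw [heq]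
      exact ⟨isCompact_singleton, by
        rw [isClosed_singleton.frontier_eq, interior_singleton, Set.sdiff_empty]⟩
    · have hfirst := firstArc_eq_image hz0 τ
      have hsecond := secondArc_eq_image hz hz0 hτ1.le
      generalize hA : z + 1 / z = a at *
      generalize hMM : (a + 2) / (a - 2) = M at *
      have hr1 : |-(4 * τ / a.im)| / 2 ≠ 0 := by
        have : 4 * τ / a.im ≠ 0 := div_ne_zero (by positivity) ha
        simpa using this
      have hr2 : ‖M‖ * (|-(4 * (1 - τ) / a.im)| / 2) ≠ 0 := by
        have : 4 * (1 - τ) / a.im ≠ 0 :=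
          div_ne_zero (mul_ne_zero (by norm_num) (by linarith)) ha
        exact mul_ne_zero (norm_ne_zero_iff.2 hM) (by simpa using this)
      have hfr := frontier_closedBall_inter_closedBall
        (1 + ((-(4 * τ / a.im) / 2 : ℝ) : ℂ) * Complex.I)
        (M - M * (((-(4 * (1 - τ) / a.im) / 2 : ℝ) : ℂ) * Complex.I)) hr1 hr2
      set L := Metric.closedBall (1 + ((-(4 * τ / a.im) / 2 : ℝ) : ℂ) * Complex.I)
        (|-(4 * τ / a.im)| / 2) ∩
        Metric.closedBall (M - M * (((-(4 * (1 - τ) / a.im) / 2 : ℝ) : ℂ) * Complex.I))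
        (‖M‖ * (|-(4 * (1 - τ) / a.im)| / 2)) with hL
      have hKL : valueRegion (slitTypicallyReal τ) z ⊆ L := fun w hw =>
        ⟨mem_closedBall_one_add.2 (mem_closedBall_half_mul_I.2 (hbound w hw).1),
          (mem_closedBall_sub_mul hM).2 (mem_closedBall_half_mul_I.2 (hbound w hw).2)⟩
      have hfrL : frontier L = firstArc z τ ∪ secondArc z τ := by
        rw [hfr]
        apply Set.Subset.antisymm
        · rintro w (⟨h1, h2⟩ | ⟨h1, h2⟩)
          · left
            rw [mem_sphere_one_add, mem_sphere_half_mul_I] at h1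
            rw [mem_closedBall_sub_mul hM, mem_closedBall_half_mul_I, ← hMM] at h2
            have hw1 : w - 1 ≠ 0 := by
              intro h0
              rw [sub_eq_zero.1 h0] at h2
              exact one_notMem_second_disc ha ⟨hτ0, hτ1⟩ h2
            obtain ⟨y, hy⟩ := exists_eq_div_of_norm_sq_eq ha hw1 h1
            have hw : w = 1 + ((4 * τ : ℝ) : ℂ) / (a - 2 * y) := by
              rw [← hy]
              ring
            rw [hw] at h2
            rw [hfirst]
            exact ⟨y, mem_Icc_of_mem_second_disc ha ⟨hτ0, hτ1⟩ h2, hw.symm⟩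
          · right
            rw [mem_closedBall_one_add, mem_closedBall_half_mul_I] at h1
            rw [mem_sphere_sub_mul hM, mem_sphere_half_mul_I] at h2
            have hw1 : 1 - w / M ≠ 0 := by
              intro h0
              have : w = M := by
                field_simp at h0
                linear_combination -h0
              rw [this, ← hMM] at h1
              exact notMem_first_disc ha ⟨hτ0, hτ1⟩ h1
            obtain ⟨x, hx⟩ := exists_eq_div_of_norm_sq_eq ha hw1 h2
            have hw : w = M * (1 - ((4 * (1 - τ) : ℝ) : ℂ) / (a - 2 * x)) := by
              rw [← hx]
              field_simp
              ring
            rw [hw, ← hMM] at h1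
            rw [hsecond]
            exact ⟨x, mem_Icc_of_mem_first_disc ha ⟨hτ0, hτ1⟩ h1, hw.symm⟩
        -- Each arc lies on its own circle, and in the other disc because its points are values of
        -- functions in the class.
        · rintro w (hw | hw)
          · exact Or.inl ⟨hs1 hw, (hKL (harcs (Or.inl hw))).2⟩
          · exact Or.inr ⟨(hKL (harcs (Or.inr hw))).1, hs2 hw⟩
      have hcomp : IsCompact L :=
        (isCompact_closedBall _ _).inter_right Metric.isClosed_closedBall
      have hK := convex_valueRegion_slitTypicallyReal.eq_of_frontier_subset hcomp hKL
        (hfrL ▸ harcs)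
      rw [hK]
      exact ⟨hcomp, hfrL⟩

theorem mainTheorem4 (z₀ : ℂ) (hz₀ : z₀ ∈ Metric.ball (0 : ℂ) 1) (hz₀' : z₀ ≠ 0)
    (τ : ℝ) (hτ : τ ∈ Set.Ioc (0 : ℝ) 1) :
    (z₀.im ≠ 0 → EuclideanGeometry.Cospherical (firstArc z₀ τ) ∧
      EuclideanGeometry.Cospherical (secondArc z₀ τ)) ∧
    Convex ℝ (closedRegionBoundedBy (firstArc z₀ τ ∪ secondArc z₀ τ)) ∧
    frontier (closedRegionBoundedBy (firstArc z₀ τ ∪ secondArc z₀ τ)) =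
      firstArc z₀ τ ∪ secondArc z₀ τ ∧
    closedRegionBoundedBy (firstArc z₀ τ ∪ secondArc z₀ τ) ⊆ Complex.slitPlane ∧
    valueRegion (boundedTypicallyRealWithDeriv τ) z₀ =
      (fun w : ℂ => (Complex.sqrt w - 1) / (Complex.sqrt w + 1)) ''
        closedRegionBoundedBy (firstArc z₀ τ ∪ secondArc z₀ τ) := by
  obtain ⟨hcomp, hfr⟩ := valueRegion_slitTypicallyReal_compact_frontier hz₀ hz₀' hτ
  have hconv : Convex ℝ (valueRegion (slitTypicallyReal τ) z₀) :=
    convex_valueRegion_slitTypicallyReal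
  have hne : (valueRegion (slitTypicallyReal τ) z₀).Nonempty :=
    ⟨_, arcs_subset_valueRegion hz₀ hτ (Or.inl ⟨1, ⟨by linarith [hτ.2], le_rfl⟩, rfl⟩)⟩
  have hW : closedRegionBoundedBy (firstArc z₀ τ ∪ secondArc z₀ τ) =
      valueRegion (slitTypicallyReal τ) z₀ := by
    rw [← hfr]
    exact closedRegionBoundedBy_frontier hcomp hconv hne
  rw [hW]
  exact ⟨fun hz' => ⟨⟨_, _, firstArc_subset_sphere hz₀ hz' τ⟩,
    ⟨_, _, secondArc_subset_sphere hz₀ hz' hτ.2⟩⟩, hconv, hfr,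
    valueRegion_slitTypicallyReal_subset_slitPlane hz₀, valueRegion_eq_image hz₀ hτ.1⟩
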